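/- Let $d\in\mathbb N$ and $\tfrac12\le\theta<1$. For $f\in C^\infty(\mathbb R^d)$ and $C>0$ put $$\|f\|_{C}=\sup_{\alpha,\beta\in\mathbb N^d}\ \sup_{x\in\mathbb R^d} C^{-|\alpha|-|\beta|}(\alpha!)^{-\theta}(\beta!)^{-\theta}|x^\alpha\partial^\beta f(x)|\in[0,\infty],$$ let $\mathcal S_\theta(\mathbb R^d)=\{f\in C^\infty(\mathbb R^d):\ \|f\|_C<\infty\text{ for some }C>0\}$ be the Gelfand-Shilov space, and let $\mathcal S_\theta'(\mathbb R^d)$ be the space of linear forms $u:\mathcal S_\theta(\mathbb R^d)\to\mathbb C$ such that for every $\varepsilon>0$ there is $C_\varepsilon>0$ with $|u(f)|\le C_\varepsilon\|f\|_\varepsilon$ for all $f\in\mathcal S_\theta(\mathbb R^d)$. A function $f\in\mathcal S_\theta(\mathbb R^d)$ is identified with the form $g\mapsto\int_{\mathbb R^d} f(y)g(y)\,dy$. Let $\varphi(z,y)=\frac12\langle Az,z\rangle+\langle Bz,y\rangle+\frac12\langle Cy,y\rangle$ ($z\in\mathbb C^d$, $y\in\mathbb R^d$, bilinear brackets) be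 an FBI phase: $A,B,C$ are complex $d\times d$ matrices, $A$ and $C$ are symmetric, $\det B\ne0$, and $\operatorname{Im}C$ is positive definite. Put $\Phi(z)=\max_{y\in\mathbb R^d}(-\operatorname{Im}\varphi(z,y))$, and for $u\in\mathcal S'_\theta(\mathbb R^d)$ let $$T_\varphi u(z)=c_\varphi\,\langle u_y,e^{i\varphi(z,y)}\rangle,\qquad c_\varphi=2^{-d/2}\pi^{-3d/4}(\det\operatorname{Im}C)^{-1/4}|\det B|,$$ be its FBI transform. Let $\chi^b_\varphi:T^*\mathbb R^d=\mathbb R^{2d}\to\mathbb C^d$ be the linear bijection that sends $(x,\xi)$ to the unique $z$ with $\xi=-\varphi'_y(z,x)$, that is, $\chi^b_\varphi(x,\xi)=-B^{-1}(\xi+Cx)$. The global wave front set $\mathrm{WF}^\theta_{\mathrm{gl}}(u)\subseteq\mathbb R^{2d}\setminus\{0\}$ is defined as follows: a point $(x_0,\xi_0)\ne(0,0)$ is not in $\mathrm{WF}^\theta_{\mathrm{gl}}(u)$ if and only if there are an open conic neighbourhood $\Gamma\subseteq\mathbb C^d$ of $\chi^b_\varphi(x_0,\xi_0)$ and constants $\varepsilon,K>0$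 with $$|T_\varphi u(z)|\le K e^{-\varepsilon|z|^{1/\theta}+\Phi(z)}\qquad\text{for all } z\in\Gamma.$$ Then, for every FBI phase $\varphi$ and every $u\in\mathcal S_\theta'(\mathbb R^d)$, $$\mathrm{WF}^\theta_{\mathrm{gl}}(u)=\emptyset\iff u\in\mathcal S_\theta(\mathbb R^d).$$ -/

import Mathlib

open MeasureTheory
open scoped ENNReal NNReal

namespace GelfandShilov

/-- Real Euclidean space `ℝ^d`. -/
abbrev RSpace (d : ℕ) : Type := EuclideanSpace ℝ (Fin d)

/-- Complex Euclidean space `ℂ^d`, with `|z|` the Euclidean norm. -/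
abbrev CSpace (d : ℕ) : Type := EuclideanSpace ℂ (Fin d)

/-- The partial derivative `∂_i f`. -/
noncomputable def partialDeriv {d : ℕ} (i : Fin d) (f : RSpace d → ℂ) : RSpace d → ℂ :=
  fun x => fderiv ℝ f x (EuclideanSpace.single i (1 : ℝ))

/-- The multi-index derivative `∂^β f = ∂_0^{β 0} ∂_1^{β 1} ⋯ f`. -/
noncomputable def multiDeriv {d : ℕ} (β : Fin d → ℕ) (f : RSpace d → ℂ) : RSpace d → ℂ :=
  (List.finRange d).foldr (fun i g => (partialDeriv i)^[β i] g) f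

/-- The length `|α|` of a multi-index. -/
def multiLength {d : ℕ} (α : Fin d → ℕ) : ℕ := ∑ i, α i

/-- The factorial `α!` of a multi-index. -/
def multiFactorial {d : ℕ} (α : Fin d → ℕ) : ℕ := ∏ i, (α i).factorial

/-- The monomial `x^α`. -/
noncomputable def monomial {d : ℕ} (α : Fin d → ℕ) (x : RSpace d) : ℝ := ∏ i, x i ^ α i

/-- The weight `C^{|α|+|β|} (α!)^θ (β!)^θ`. -/
noncomputable def gsWeight {d : ℕ} (θ C : ℝ) (α β : Fin d → ℕ) : ℝ :=
  C ^ (multiLength α + multiLength β) * (multiFactorial α : ℝ) ^ θ * (multiFactorial β : ℝ) ^ θ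

/-- The Gelfand-Shilov norm (with values in `[0, ∞]`)
`sup_{α, β} sup_x C^{-|α|-|β|} (α!)^{-θ} (β!)^{-θ} |x^α ∂^β f(x)|`. -/
noncomputable def gsNorm {d : ℕ} (θ C : ℝ) (f : RSpace d → ℂ) : ℝ≥0∞ :=
  ⨆ (α : Fin d → ℕ) (β : Fin d → ℕ) (x : RSpace d),
    ENNReal.ofReal (|monomial α x| * ‖multiDeriv β f x‖ / gsWeight θ C α β)

/-- Membership in the Gelfand-Shilov space `S_θ(ℝ^d)`. -/
def MemGS {d : ℕ} (θ : ℝ) (f : RSpace d → ℂ) : Prop :=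
  ContDiff ℝ ((⊤ : ℕ∞) : WithTop ℕ∞) f ∧ ∃ C : ℝ, 0 < C ∧ gsNorm θ C f < ∞

/-! ### `S_θ(ℝ^d)` is a vector space -/

section VectorSpace

variable {d : ℕ}

lemma contDiff_partialDeriv {i : Fin d} {f : RSpace d → ℂ}
    (hf : ContDiff ℝ ((⊤ : ℕ∞) : WithTop ℕ∞) f) :
    ContDiff ℝ ((⊤ : ℕ∞) : WithTop ℕ∞) (partialDeriv i f) := by
  unfold partialDeriv
  exact (hf.fderiv_right (m := ((⊤ : ℕ∞) : WithTop ℕ∞)) (by simp)).clm_apply contDiff_const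

lemma partialDeriv_add {i : Fin d} {f g : RSpace d → ℂ}
    (hf : ContDiff ℝ ((⊤ : ℕ∞) : WithTop ℕ∞) f) (hg : ContDiff ℝ ((⊤ : ℕ∞) : WithTop ℕ∞) g) :
    partialDeriv i (f + g) = partialDeriv i f + partialDeriv i g := by
  funext x
  simp [partialDeriv, fderiv_add (hf.differentiable (by simp) x) (hg.differentiable (by simp) x)]

lemma partialDeriv_smul {i : Fin d} {f : RSpace d → ℂ} (c : ℂ)
    (hf : ContDiff ℝ ((⊤ : ℕ∞) : WithTop ℕ∞) f) :
    partialDeriv i (c • f) = c • partialDeriv i f := by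
  funext x
  simp [partialDeriv, fderiv_const_smul (hf.differentiable (by simp) x) c]

lemma iterate_partialDeriv_props (i : Fin d) (n : ℕ) :
    ∀ {f g : RSpace d → ℂ}, ContDiff ℝ ((⊤ : ℕ∞) : WithTop ℕ∞) f →
      ContDiff ℝ ((⊤ : ℕ∞) : WithTop ℕ∞) g → ∀ c : ℂ,
      ContDiff ℝ ((⊤ : ℕ∞) : WithTop ℕ∞) ((partialDeriv i)^[n] f) ∧
      (partialDeriv i)^[n] (f + g) = (partialDeriv i)^[n] f + (partialDeriv i)^[n] g ∧
      (partialDeriv i)^[n] (c • f) = c • (partialDeriv i)^[n] f := by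
  induction n with
  | zero => intro f g hf _ c; exact ⟨hf, rfl, rfl⟩
  | succ n ih =>
    intro f g hf hg c
    have h := ih (contDiff_partialDeriv (i := i) hf) (contDiff_partialDeriv (i := i) hg) c
    simpa only [Function.iterate_succ_apply, partialDeriv_add hf hg, partialDeriv_smul c hf]
      using h

lemma multiDeriv_props (β : Fin d → ℕ) {f g : RSpace d → ℂ}
    (hf : ContDiff ℝ ((⊤ : ℕ∞) : WithTop ℕ∞) f) (hg : ContDiff ℝ ((⊤ : ℕ∞) : WithTop ℕ∞) g)
    (c : ℂ) :
    multiDeriv β (f + g) = multiDeriv β f + multiDeriv β g ∧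
      multiDeriv β (c • f) = c • multiDeriv β f := by
  unfold multiDeriv
  suffices H : ∀ l : List (Fin d), ∀ h : RSpace d → ℂ, (h = f ∨ h = g) →
      ContDiff ℝ ((⊤ : ℕ∞) : WithTop ℕ∞)
        (l.foldr (fun i g => (partialDeriv i)^[β i] g) h) ∧
      l.foldr (fun i g => (partialDeriv i)^[β i] g) (f + g) =
        l.foldr (fun i g => (partialDeriv i)^[β i] g) f +
          l.foldr (fun i g => (partialDeriv i)^[β i] g) g ∧
      l.foldr (fun i g => (partialDeriv i)^[β i] g) (c • f) =
        c • l.foldr (fun i g => (partialDeriv i)^[β i] g) f from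
    (H _ f (Or.inl rfl)).2
  intro l
  induction l with
  | nil =>
    rintro h (rfl | rfl)
    · exact ⟨hf, rfl, rfl⟩
    · exact ⟨hg, rfl, rfl⟩
  | cons i l ih =>
    intro h hh
    have h1 := ih f (Or.inl rfl)
    have h2 := ih g (Or.inr rfl)
    have h3 := ih h hh
    simp only [List.foldr_cons]
    rw [h1.2.1, h1.2.2]
    exact ⟨(iterate_partialDeriv_props i (β i) h3.1 h3.1 c).1,
      (iterate_partialDeriv_props i (β i) h1.1 h2.1 c).2⟩

lemma gsWeight_pos {θ C : ℝ} (hC : 0 < C) (α β : Fin d → ℕ) : 0 < gsWeight θ C α β := by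
  have h : ∀ γ : Fin d → ℕ, (0 : ℝ) < (multiFactorial γ : ℝ) := fun γ => by
    exact_mod_cast Finset.prod_pos fun i _ => Nat.factorial_pos (γ i)
  unfold gsWeight
  have := Real.rpow_pos_of_pos (h α) θ
  have := Real.rpow_pos_of_pos (h β) θ
  positivity

lemma gsWeight_mono {θ C C' : ℝ} (hC : 0 < C) (h : C ≤ C') (α β : Fin d → ℕ) :
    gsWeight θ C α β ≤ gsWeight θ C' α β := by
  unfold gsWeight
  gcongr

lemma gsNorm_anti {θ C C' : ℝ} (hC : 0 < C) (h : C ≤ C') (f : RSpace d → ℂ) :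
    gsNorm θ C' f ≤ gsNorm θ C f := by
  refine iSup_mono fun α => iSup_mono fun β => iSup_mono fun x => ENNReal.ofReal_le_ofReal ?_
  exact div_le_div_of_nonneg_left (by positivity) (gsWeight_pos hC α β) (gsWeight_mono hC h α β)

lemma le_gsNorm (θ C : ℝ) (f : RSpace d → ℂ) (α β : Fin d → ℕ) (x : RSpace d) :
    ENNReal.ofReal (|monomial α x| * ‖multiDeriv β f x‖ / gsWeight θ C α β) ≤ gsNorm θ C f :=
  le_iSup_of_le α (le_iSup_of_le β (le_iSup
    (fun x => ENNReal.ofReal (|monomial α x| * ‖multiDeriv β f x‖ / gsWeight θ C α β)) x))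

lemma gsNorm_add_le {θ C : ℝ} (hC : 0 < C) {f g : RSpace d → ℂ}
    (hf : ContDiff ℝ ((⊤ : ℕ∞) : WithTop ℕ∞) f) (hg : ContDiff ℝ ((⊤ : ℕ∞) : WithTop ℕ∞) g) :
    gsNorm θ C (f + g) ≤ gsNorm θ C f + gsNorm θ C g := by
  refine iSup_le fun α => iSup_le fun β => iSup_le fun x => ?_
  refine le_trans ?_ (add_le_add (le_gsNorm θ C f α β x) (le_gsNorm θ C g α β x))
  have hw := gsWeight_pos (θ := θ) hC α β
  rw [← ENNReal.ofReal_add (by positivity) (by positivity)]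
  apply ENNReal.ofReal_le_ofReal
  rw [(multiDeriv_props β hf hg 1).1, ← add_div, ← mul_add]
  gcongr
  exact norm_add_le _ _

lemma gsNorm_smul_le {θ C : ℝ} (hC : 0 < C) (c : ℂ) {f : RSpace d → ℂ}
    (hf : ContDiff ℝ ((⊤ : ℕ∞) : WithTop ℕ∞) f) :
    gsNorm θ C (c • f) ≤ ENNReal.ofReal ‖c‖ * gsNorm θ C f := by
  refine iSup_le fun α => iSup_le fun β => iSup_le fun x => ?_
  refine le_trans ?_ (mul_le_mul_right (le_gsNorm θ C f α β x) _)
  have hw := gsWeight_pos (θ := θ) hC α β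
  rw [← ENNReal.ofReal_mul (norm_nonneg c)]
  apply ENNReal.ofReal_le_ofReal
  rw [(multiDeriv_props β hf hf c).2]
  simp only [Pi.smul_apply, smul_eq_mul, norm_mul]
  apply le_of_eq
  ring

lemma MemGS.add {θ : ℝ} {f g : RSpace d → ℂ} (hf : MemGS θ f) (hg : MemGS θ g) :
    MemGS θ (f + g) := by
  obtain ⟨hf, C, hC, hfC⟩ := hf
  obtain ⟨hg, D, hD, hgD⟩ := hg
  have hM : 0 < max C D := lt_max_of_lt_left hC
  refine ⟨hf.add hg, max C D, hM, (gsNorm_add_le hM hf hg).trans_lt (ENNReal.add_lt_top.2 ⟨?_, ?_⟩)⟩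
  · exact (gsNorm_anti hC (le_max_left C D) f).trans_lt hfC
  · exact (gsNorm_anti hD (le_max_right C D) g).trans_lt hgD

lemma MemGS.smul {θ : ℝ} (c : ℂ) {f : RSpace d → ℂ} (hf : MemGS θ f) : MemGS θ (c • f) := by
  obtain ⟨hf, C, hC, hfC⟩ := hf
  exact ⟨contDiff_const.smul hf, C, hC,
    (gsNorm_smul_le hC c hf).trans_lt (ENNReal.mul_lt_top ENNReal.ofReal_lt_top hfC)⟩

lemma memGS_zero {θ : ℝ} : MemGS θ (0 : RSpace d → ℂ) := by
  refine ⟨contDiff_const, 1, one_pos, ?_⟩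
  have h : ContDiff ℝ ((⊤ : ℕ∞) : WithTop ℕ∞) (0 : RSpace d → ℂ) := contDiff_const
  have h0 := gsNorm_smul_le (θ := θ) one_pos 0 h
  have hz : gsNorm θ 1 (0 : RSpace d → ℂ) = 0 := by
    refine le_antisymm (iSup_le fun α => iSup_le fun β => iSup_le fun x => ?_) zero_le
    have := (multiDeriv_props β h h 0).2
    rw [zero_smul, zero_smul] at this
    simp [this]
  rw [hz]
  exact ENNReal.zero_lt_top

end VectorSpace

/-- The Gelfand-Shilov space `S_θ(ℝ^d)`, the union over `C > 0` of the spaces of smooth functions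
with finite norm `gsNorm θ C`. -/
def GS (d : ℕ) (θ : ℝ) : Submodule ℂ (RSpace d → ℂ) where
  carrier := {f | MemGS θ f}
  add_mem' := MemGS.add
  zero_mem' := memGS_zero
  smul_mem' := fun c _ hf => MemGS.smul c hf

/-- The space `S'_θ(ℝ^d)` of tempered ultradistributions: linear forms `u` on `S_θ(ℝ^d)` such that
for every `ε > 0` there is `K > 0` with `|u(f)| ≤ K ‖f‖_ε` for all `f`, where `‖f‖_ε` is
`gsNorm θ ε f` (no condition on those `f` for which it is infinite). -/
structure GSDual (d : ℕ) (θ : ℝ) extends GS d θ →ₗ[ℂ] ℂ where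
  bound' : ∀ ε : ℝ, 0 < ε → ∃ K : ℝ≥0, 0 < K ∧
    ∀ f : GS d θ, ‖toLinearMap f‖ₑ ≤ K * gsNorm θ ε (f : RSpace d → ℂ)

/-- `u ∈ S_θ(ℝ^d)`: the ultradistribution `u` is given by integration against a function in
`S_θ(ℝ^d)`. -/
def GSDual.IsGS {d : ℕ} {θ : ℝ} (u : GSDual d θ) : Prop :=
  ∃ f : GS d θ, ∀ g : GS d θ,
    u.toLinearMap g = ∫ y : RSpace d, (f : RSpace d → ℂ) y * (g : RSpace d → ℂ) y

/-- The data of an FBI phase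
`φ(z, y) = ½⟨A z, z⟩ + ⟨B z, y⟩ + ½⟨C y, y⟩` on `ℂ^d × ℝ^d`, with `A`, `C` symmetric,
`det B ≠ 0` and `Im C > 0`; the brackets are bilinear. -/
structure FBIPhase (d : ℕ) where
  A : Matrix (Fin d) (Fin d) ℂ
  B : Matrix (Fin d) (Fin d) ℂ
  C : Matrix (Fin d) (Fin d) ℂ
  A_symm : A.IsSymm
  C_symm : C.IsSymm
  det_B_ne_zero : B.det ≠ 0
  im_C_posDef : (C.map Complex.im).PosDef

namespace FBIPhase

variable {d : ℕ} (φ : FBIPhase d)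

/-- The inclusion `ℝ^d → ℂ^d` in coordinates. -/
def toComplexCoords (y : RSpace d) : Fin d → ℂ := fun i => (y i : ℂ)

/-- The value `φ(z, y)`. -/
noncomputable def phase (z : CSpace d) (y : RSpace d) : ℂ :=
  (1 / 2 : ℂ) * dotProduct (φ.A.mulVec z.ofLp) z.ofLp
    + dotProduct (φ.B.mulVec z.ofLp) (toComplexCoords y)
    + (1 / 2 : ℂ) * dotProduct (φ.C.mulVec (toComplexCoords y)) (toComplexCoords y)

/-- The weight `Φ(z) = max_y (-Im φ(z, y))`; the maximum exists since `Im C > 0`. -/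
noncomputable def weight (z : CSpace d) : ℝ := ⨆ y : RSpace d, -(φ.phase z y).im

/-- `c_φ = 2^{-d/2} π^{-3d/4} (det Im C)^{-1/4} |det B|`. -/
noncomputable def normConst : ℝ :=
  (2 : ℝ) ^ (-(d : ℝ) / 2) * Real.pi ^ (-(3 * (d : ℝ)) / 4)
    * (φ.C.map Complex.im).det ^ (-(1 : ℝ) / 4) * ‖φ.B.det‖

/-- The function `y ↦ e^{iφ(z, y)}`. -/
noncomputable def kernel (z : CSpace d) : RSpace d → ℂ :=
  fun y => Complex.exp (Complex.I * φ.phase z y)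

/-- The linear bijection `χ♭_φ : T*ℝ^d → ℂ^d` which sends `(x, ξ)` to the unique `z` with
`ξ = -φ'_y(z, x)`. As `φ'_y(z, x) = B z + C x`, this is `z = -B⁻¹ (ξ + C x)`. -/
noncomputable def chiFlat (x ξ : RSpace d) : CSpace d :=
  WithLp.toLp 2 (-(φ.B⁻¹.mulVec (toComplexCoords ξ + φ.C.mulVec (toComplexCoords x))))

end FBIPhase

open Classical in
/-- The FBI transform `T_φ u(z) = c_φ ⟨u_y, e^{iφ(z, y)}⟩`. For `θ ≥ 1/2` the Gaussian
`e^{iφ(z, ·)}` lies in `S_{1/2}(ℝ^d) ⊆ S_θ(ℝ^d)`, so that the second branch does not occur. -/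
noncomputable def GSDual.fbi {d : ℕ} {θ : ℝ} (u : GSDual d θ) (φ : FBIPhase d) (z : CSpace d) : ℂ :=
  if h : φ.kernel z ∈ GS d θ then (φ.normConst : ℂ) * u.toLinearMap ⟨φ.kernel z, h⟩ else 0

/-- A cone in `ℂ^d`: a set stable under multiplication by positive reals. -/
def IsConic {d : ℕ} (Γ : Set (CSpace d)) : Prop :=
  ∀ z ∈ Γ, ∀ t : ℝ, 0 < t → t • z ∈ Γ

/-- The estimate `|T_φ u(z)| ≲ e^{-ε|z|^{1/θ} + Φ(z)}` holds, for some `ε > 0`, on some open conic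
neighbourhood of `χ♭_φ(x, ξ)`. -/
def GSDual.IsRegularAt {d : ℕ} {θ : ℝ} (u : GSDual d θ) (φ : FBIPhase d) (x ξ : RSpace d) : Prop :=
  ∃ Γ : Set (CSpace d), IsOpen Γ ∧ IsConic Γ ∧ φ.chiFlat x ξ ∈ Γ ∧
    ∃ ε : ℝ, 0 < ε ∧ ∃ K : ℝ, 0 < K ∧
      ∀ z ∈ Γ, ‖u.fbi φ z‖ ≤ K * Real.exp (-ε * ‖z‖ ^ (1 / θ) + φ.weight z)

/-- The global wave front set `WF^θ_gl(u) ⊆ T*ℝ^d \ {(0, 0)}`, computed with the phase `φ`. -/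
def GSDual.waveFrontSet {d : ℕ} {θ : ℝ} (u : GSDual d θ) (φ : FBIPhase d) :
    Set (RSpace d × RSpace d) :=
  {p | p ≠ 0 ∧ ¬ u.IsRegularAt φ p.1 p.2}

end GelfandShilov

namespace GelfandShilov

open Filter Topology Matrix
open scoped FourierTransform

/-! Write `z = χ♭(x, 2πη)`. There `y ↦ φ(z, y)` has derivative `-2πη` at `y = x`, so its exact
Taylor expansion shows that `e^{iφ(z,·)}` is a constant of modulus `e^{Φ(z)}` times the Gaussian
wave packet `packet φ.C (x, η)` (`kernel_chiEquiv`). Up to the factor `c_φ e^{Φ}`, the FBI transform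
therefore has the modulus of the short-time Fourier transform `stft`, and `χ♭` is a real linear
isomorphism. Regularity at a point becomes decay `e^{-ε|p|^{1/θ}}` of the `stft` in a cone, and by
compactness of the sphere an empty wave front set means such decay on all of phase space
(`exists_decay_of_conic_decay`). It remains to see that this decay characterises `S_θ`.

If `u` is given by `f ∈ S_θ`, decay in `x` comes from the decay of `f` and of the window; decay in
`η` comes from `n` integrations by parts, whose `(n!)^θ` bounds are summed into an exponential
(`exists_norm_integral_mul_packet_le`).

Conversely, a test function `g` is the superposition of packets weighted by its own transform
(`integral_stft_mul_packet`, Fourier inversion in `η` for fixed `x`). Applying `u` under the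
integral and exchanging the roles of `u` and `g` gives `u(g) = ∫ f g`, where `f` is the
superposition of conjugate packets weighted by the `stft` of `u`. Both the membership `f ∈ S_θ` and
the exchange of `u` with the integral are `exists_superposition`. It rests on
`exists_gsNorm_packet_le`: for every `δ > 0` some Gelfand-Shilov norm of the packets grows at most
like `e^{δ|p|^{1/θ}}`, which any given exponential decay beats. That bound is a Cauchy estimate on
polydiscs of radius `n^{1-θ}`, and `θ ≥ 1/2` keeps the Gaussian growth `e^{Dr²}` below `e^{Dn}`. -/

/-! ### Factorial powers against exponentials of `t^{1/θ}`. -/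

/-- A single term of the exponential series at `δ t^{1/θ} / θ` is at most the sum; raise this to the
power `θ`. -/
lemma pow_le_factorial_rpow_mul_exp {θ δ t : ℝ} (hθ : 0 < θ) (hδ : 0 < δ) (ht : 0 ≤ t) (n : ℕ) :
    t ^ n ≤ ((θ / δ) ^ θ) ^ n * (n.factorial : ℝ) ^ θ * Real.exp (δ * t ^ (1 / θ)) := by
  have hn : (0 : ℝ) < n.factorial := by positivity
  have hT : 0 ≤ t ^ (1 / θ) := by positivity
  have h := Real.pow_div_factorial_le_exp (δ * t ^ (1 / θ) / θ) (by positivity) n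
  rw [div_le_iff₀ hn] at h
  have h2 := Real.rpow_le_rpow (by positivity) h hθ.le
  have e1 : ((δ * t ^ (1 / θ) / θ) ^ n) ^ θ = ((δ / θ) ^ θ) ^ n * t ^ n := by
    have : δ * t ^ (1 / θ) / θ = (δ / θ) * t ^ (1 / θ) := by ring
    rw [this, mul_pow, Real.mul_rpow (by positivity) (by positivity), Real.rpow_pow_comm ht,
      ← Real.rpow_mul (by positivity), Real.rpow_pow_comm (by positivity : 0 ≤ δ / θ)]
    simp [hθ.ne']
  have e2 : (Real.exp (δ * t ^ (1 / θ) / θ) * n.factorial) ^ θ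
      = Real.exp (δ * t ^ (1 / θ)) * (n.factorial : ℝ) ^ θ := by
    rw [Real.mul_rpow (by positivity) (by positivity), ← Real.exp_mul]
    congr 2
    field_simp
  rw [e1, e2] at h2
  have e3 : ((θ / δ) ^ θ) ^ n * ((δ / θ) ^ θ) ^ n = 1 := by
    rw [← mul_pow, ← Real.mul_rpow (by positivity) (by positivity)]
    have : θ / δ * (δ / θ) = 1 := by field_simp
    simp [this]
  calc t ^ n = ((θ / δ) ^ θ) ^ n * (((δ / θ) ^ θ) ^ n * t ^ n) := by rw [← mul_assoc, e3, one_mul]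
    _ ≤ ((θ / δ) ^ θ) ^ n * (Real.exp (δ * t ^ (1 / θ)) * (n.factorial : ℝ) ^ θ) := by gcongr
    _ = _ := by ring

/-- Converse direction: after raising to the power `1/θ`, the bounds for all `n` are weighted and
summed, an exponential series on the left against a geometric one on the right. -/
lemma le_exp_neg_of_forall_pow_mul_le {θ C t A K : ℝ} (hθ : 0 < θ) (hC : 0 < C) (ht : 0 ≤ t)
    (hA : 0 ≤ A) (hK : 0 ≤ K) (h : ∀ n : ℕ, t ^ n * A ≤ K * C ^ n * (n.factorial : ℝ) ^ θ) :
    A ≤ 2 ^ θ * K * Real.exp (-(θ / (2 * C ^ (1 / θ))) * t ^ (1 / θ)) := by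
  set c := C ^ (1 / θ) with hc
  set T := t ^ (1 / θ) with hT
  have hc0 : 0 < c := by positivity
  have hT0 : 0 ≤ T := by positivity
  -- The `n`-th bound is divided by `(2c)^n n!`; the spare `2^n` makes the right-hand side summable
  -- and is the origin of the factor `2^θ`.
  have key : ∀ n : ℕ, (T / (2 * c)) ^ n / n.factorial * A ^ (1 / θ)
      ≤ K ^ (1 / θ) * (1 / 2 : ℝ) ^ n := by
    intro n
    have h1 := Real.rpow_le_rpow (by positivity) (h n) (by positivity : 0 ≤ 1 / θ)
    rw [Real.mul_rpow (by positivity) hA, Real.mul_rpow (by positivity) (by positivity),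
      Real.mul_rpow hK (by positivity), ← Real.rpow_mul (by positivity),
      mul_one_div_cancel hθ.ne', Real.rpow_one, ← Real.rpow_pow_comm ht,
      ← Real.rpow_pow_comm hC.le, ← hc, ← hT] at h1
    have hn : (0 : ℝ) < n.factorial := by positivity
    calc (T / (2 * c)) ^ n / n.factorial * A ^ (1 / θ)
        = (T ^ n * A ^ (1 / θ)) / (2 ^ n * c ^ n * n.factorial) := by
          rw [div_pow, mul_pow]; field_simp
      _ ≤ (K ^ (1 / θ) * c ^ n * n.factorial) / (2 ^ n * c ^ n * n.factorial) := by gcongr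
      _ = _ := by rw [div_pow, one_pow]; field_simp
  have hs1 : HasSum (fun n : ℕ => (T / (2 * c)) ^ n / n.factorial * A ^ (1 / θ))
      (Real.exp (T / (2 * c)) * A ^ (1 / θ)) := by
    have := NormedSpace.expSeries_div_hasSum_exp (𝔸 := ℝ) (T / (2 * c))
    rw [← Real.exp_eq_exp_ℝ] at this
    exact this.mul_right _
  have hs2 : HasSum (fun n : ℕ => K ^ (1 / θ) * (1 / 2 : ℝ) ^ n) (K ^ (1 / θ) * 2) :=
    hasSum_geometric_two.mul_left _
  have h3 := hasSum_le key hs1 hs2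
  have h4 := Real.rpow_le_rpow (by positivity) h3 hθ.le
  rw [Real.mul_rpow (by positivity) (by positivity), Real.mul_rpow (by positivity) (by positivity),
    ← Real.rpow_mul hA, ← Real.rpow_mul hK, one_div_mul_cancel hθ.ne', Real.rpow_one,
    Real.rpow_one, ← Real.exp_mul] at h4
  calc A = Real.exp (-(θ / (2 * c)) * T) * (Real.exp (T / (2 * c) * θ) * A) := by
        rw [← mul_assoc, ← Real.exp_add]
        have : -(θ / (2 * c)) * T + T / (2 * c) * θ = 0 := by ring
        rw [this, Real.exp_zero, one_mul]
    _ ≤ Real.exp (-(θ / (2 * c)) * T) * (K * 2 ^ θ) := by gcongr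
    _ = _ := by ring

/-- The radius used in the Cauchy estimate for the `n`-th derivative. -/
noncomputable def cauchyRadius (θ : ℝ) (n : ℕ) : ℝ := (max (n : ℝ) 1) ^ (1 - θ)

lemma cauchyRadius_pos (θ : ℝ) (n : ℕ) : 0 < cauchyRadius θ n := by
  unfold cauchyRadius
  positivity

/-- From `n! ≤ n^n` one gets `(n!)^{1-θ} ≤ r^n` for the radius `r = n^{1-θ}`. The maximum with `1`
in the radius only matters at `n = 0`. -/
lemma factorial_div_cauchyRadius_pow_le {θ : ℝ} (hθ' : θ < 1) (n : ℕ) :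
    (n.factorial : ℝ) / cauchyRadius θ n ^ n ≤ (n.factorial : ℝ) ^ θ := by
  have hr := cauchyRadius_pos θ n
  have hn : (0 : ℝ) < n.factorial := by positivity
  have hN : (0 : ℝ) < max (n : ℝ) 1 := by positivity
  rw [div_le_iff₀ (by positivity)]
  have h1 : (n.factorial : ℝ) ≤ (max (n : ℝ) 1) ^ n := by
    calc (n.factorial : ℝ) ≤ (n : ℝ) ^ n := by exact_mod_cast Nat.factorial_le_pow n
      _ ≤ _ := by gcongr; exact le_max_left _ _
  have h2 := Real.rpow_le_rpow hn.le h1 (by linarith : 0 ≤ 1 - θ)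
  rw [← Real.rpow_pow_comm hN.le] at h2
  calc (n.factorial : ℝ) = (n.factorial : ℝ) ^ θ * (n.factorial : ℝ) ^ (1 - θ) := by
        rw [← Real.rpow_add hn]; simp
    _ ≤ _ := by unfold cauchyRadius; gcongr

/-- Young's inequality with exponents `1/θ` and `1/(1-θ)` splits `s r` into `δ s^{1/θ}` and a
multiple of `r^{1/(1-θ)} = max n 1`. The Gaussian term satisfies `r² ≤ max n 1` because `2(1-θ) ≤
1`; this is where `θ ≥ 1/2` enters. -/
lemma exists_cauchy_factor_le {θ δ D : ℝ} (hθ : 1 / 2 ≤ θ) (hθ' : θ < 1) (hδ : 0 < δ)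
    (hD : 0 ≤ D) :
    ∃ E : ℝ, 0 ≤ E ∧ ∀ (n : ℕ) (s : ℝ), 0 ≤ s →
      (n.factorial : ℝ) / cauchyRadius θ n ^ n
          * Real.exp (s * cauchyRadius θ n + D * cauchyRadius θ n ^ 2)
        ≤ Real.exp E * Real.exp E ^ n * (n.factorial : ℝ) ^ θ * Real.exp (δ * s ^ (1 / θ)) := by
  have hθ0 : 0 < θ := by linarith
  -- Scaling `s` by `ρ` and the radius by `ρ⁻¹` makes Young's inequality produce exactly `δ
  -- s^{1/θ}`.
  set ρ := δ ^ θ with hρ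
  have hρ0 : 0 < ρ := by positivity
  set E := ρ⁻¹ ^ (1 / (1 - θ)) + D with hE
  have h1θ : 0 < 1 - θ := by linarith
  refine ⟨E, by positivity, fun n s hs => ?_⟩
  set N := max (n : ℝ) 1 with hN
  have hN1 : 1 ≤ N := le_max_right _ _
  have hN0 : 0 < N := by linarith
  have hNn : N ≤ n + 1 := max_le (by linarith) (by linarith [(Nat.cast_nonneg n : (0 : ℝ) ≤ n)])
  have hr : cauchyRadius θ n = N ^ (1 - θ) := rfl
  have hr2 : cauchyRadius θ n ^ 2 ≤ N := by
    rw [hr, ← Real.rpow_mul_natCast hN0.le]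
    calc N ^ ((1 - θ) * (2 : ℕ)) ≤ N ^ (1 : ℝ) :=
          Real.rpow_le_rpow_of_exponent_le hN1 (by push_cast; linarith)
      _ = N := Real.rpow_one N
  have hsr : s * cauchyRadius θ n ≤ δ * s ^ (1 / θ) + ρ⁻¹ ^ (1 / (1 - θ)) * N := by
    have hconj : (1 / θ).HolderConjugate (1 / (1 - θ)) := by
      rw [Real.holderConjugate_iff]
      refine ⟨by rw [lt_div_iff₀ hθ0]; linarith, by simp⟩
    have hy := Real.young_inequality_of_nonneg (a := ρ * s) (b := ρ⁻¹ * cauchyRadius θ n)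
      (by positivity) (by have := cauchyRadius_pos θ n; positivity) hconj
    have e0 : ρ * s * (ρ⁻¹ * cauchyRadius θ n) = s * cauchyRadius θ n := by field_simp
    have e1 : (ρ * s) ^ (1 / θ) = δ * s ^ (1 / θ) := by
      rw [Real.mul_rpow hρ0.le hs, hρ, ← Real.rpow_mul hδ.le]
      simp [hθ0.ne']
    have e2 : (ρ⁻¹ * cauchyRadius θ n) ^ (1 / (1 - θ)) = ρ⁻¹ ^ (1 / (1 - θ)) * N := by
      rw [Real.mul_rpow (by positivity) (cauchyRadius_pos θ n).le, hr, ← Real.rpow_mul hN0.le]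
      simp [h1θ.ne']
    rw [e0, e1, e2] at hy
    have h3 : δ * s ^ (1 / θ) / (1 / θ) ≤ δ * s ^ (1 / θ) := by
      rw [div_div_eq_mul_div, div_one]
      exact mul_le_of_le_one_right (by positivity) hθ'.le
    have h4 : ρ⁻¹ ^ (1 / (1 - θ)) * N / (1 / (1 - θ)) ≤ ρ⁻¹ ^ (1 / (1 - θ)) * N := by
      rw [div_div_eq_mul_div, div_one]
      exact mul_le_of_le_one_right (by positivity) (by linarith)
    linarith
  have h5 : s * cauchyRadius θ n + D * cauchyRadius θ n ^ 2
      ≤ E + n * E + δ * s ^ (1 / θ) := by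
    have : D * cauchyRadius θ n ^ 2 ≤ D * N := by gcongr
    have h6 : E * N ≤ E * (n + 1) := by gcongr
    have h7 : E * N = ρ⁻¹ ^ (1 / (1 - θ)) * N + D * N := by rw [hE]; ring
    linarith
  calc (n.factorial : ℝ) / cauchyRadius θ n ^ n
          * Real.exp (s * cauchyRadius θ n + D * cauchyRadius θ n ^ 2)
      ≤ (n.factorial : ℝ) ^ θ * Real.exp (E + n * E + δ * s ^ (1 / θ)) := by
        gcongr
        exact factorial_div_cauchyRadius_pow_le hθ' n
    _ = _ := by rw [Real.exp_add, Real.exp_add, Real.exp_nat_mul]; ring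

lemma rpow_le_one_add_sq {q t : ℝ} (hq : 0 ≤ q) (hq' : q ≤ 2) (ht : 0 ≤ t) :
    t ^ q ≤ 1 + t ^ 2 := by
  rcases le_total t 1 with h | h
  · have := Real.rpow_le_one ht h hq
    nlinarith [sq_nonneg t]
  · calc t ^ q ≤ t ^ (2 : ℝ) := Real.rpow_le_rpow_of_exponent_le h hq'
      _ ≤ 1 + t ^ 2 := by rw [Real.rpow_two]; linarith

lemma le_one_add_rpow {q t : ℝ} (hq : 1 ≤ q) (ht : 0 ≤ t) : t ≤ 1 + t ^ q := by
  rcases le_total t 1 with h | h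
  · have : 0 ≤ t ^ q := by positivity
    linarith
  · calc t = t ^ (1 : ℝ) := (Real.rpow_one t).symm
      _ ≤ t ^ q := Real.rpow_le_rpow_of_exponent_le h hq
      _ ≤ _ := by linarith

/-- Since `q ≤ 2`, moving the base point costs only a quadratic term, which a Gaussian can absorb.
-/
lemma abs_rpow_le_shift {q : ℝ} (hq : 0 ≤ q) (hq' : q ≤ 2) (a b : ℝ) :
    |a| ^ q ≤ 4 * |b| ^ q + 4 * (a - b) ^ 2 + 4 := by
  have h1 : |a| ≤ 2 * max |b| |a - b| := by
    have : |a| ≤ |b| + |a - b| := by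
      have := abs_add_le b (a - b); simpa using this
    linarith [le_max_left |b| |a - b|, le_max_right |b| |a - b|]
  have h2 : (2 : ℝ) ^ q ≤ 4 := by
    calc (2 : ℝ) ^ q ≤ 2 ^ (2 : ℝ) := Real.rpow_le_rpow_of_exponent_le one_le_two hq'
      _ = 4 := by norm_num
  have h3 : (max |b| |a - b|) ^ q ≤ |b| ^ q + |a - b| ^ q := by
    rcases max_cases |b| |a - b| with ⟨h, _⟩ | ⟨h, _⟩ <;> rw [h]
    · have : 0 ≤ |a - b| ^ q := by positivity
      linarith
    · have : 0 ≤ |b| ^ q := by positivity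
      linarith
  have h4 := rpow_le_one_add_sq hq hq' (abs_nonneg (a - b))
  rw [sq_abs] at h4
  calc |a| ^ q ≤ (2 * max |b| |a - b|) ^ q := Real.rpow_le_rpow (abs_nonneg a) h1 hq
    _ = 2 ^ q * (max |b| |a - b|) ^ q := Real.mul_rpow (by norm_num) (by positivity)
    _ ≤ 4 * (|b| ^ q + |a - b| ^ q) := by gcongr
    _ ≤ _ := by linarith

/-! ### Entire functions restricted to `ℝ^d` and Cauchy estimates. -/

variable {d : ℕ}

/-- The inclusion `ℝ^d → ℂ^d` as a continuous real-linear map. -/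
noncomputable def realEmbed (d : ℕ) : RSpace d →L[ℝ] (Fin d → ℂ) :=
  ContinuousLinearMap.pi fun i => Complex.ofRealCLM.comp (EuclideanSpace.proj i)

@[simp] lemma realEmbed_apply (y : RSpace d) (i : Fin d) : realEmbed d y i = (y i : ℂ) := rfl

lemma realEmbed_eq_toComplexCoords (y : RSpace d) :
    realEmbed d y = FBIPhase.toComplexCoords y := rfl

/-- Entire functions on `ℂ^d`. -/
def IsEntire (F : (Fin d → ℂ) → ℂ) : Prop := ContDiff ℂ ((⊤ : ℕ∞) : WithTop ℕ∞) F

/-- The complex partial derivative. -/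
noncomputable def complexPartial (i : Fin d) (F : (Fin d → ℂ) → ℂ) : (Fin d → ℂ) → ℂ :=
  fun z => fderiv ℂ F z (Pi.single i 1)

lemma IsEntire.differentiable {F : (Fin d → ℂ) → ℂ} (hF : IsEntire F) : Differentiable ℂ F :=
  ContDiff.differentiable hF (by simp)

lemma IsEntire.complexPartial {F : (Fin d → ℂ) → ℂ} (hF : IsEntire F) (i : Fin d) :
    IsEntire (complexPartial i F) :=
  (ContDiff.fderiv_right (m := ((⊤ : ℕ∞) : WithTop ℕ∞)) hF (by simp)).clm_apply contDiff_const

lemma IsEntire.iterate_complexPartial {F : (Fin d → ℂ) → ℂ} (hF : IsEntire F) (i : Fin d)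
    (n : ℕ) : IsEntire ((GelfandShilov.complexPartial i)^[n] F) := by
  induction n generalizing F with
  | zero => exact hF
  | succ n ih => exact ih (hF.complexPartial i)

lemma IsEntire.contDiff_comp_realEmbed {F : (Fin d → ℂ) → ℂ} (hF : IsEntire F) :
    ContDiff ℝ ((⊤ : ℕ∞) : WithTop ℕ∞) (F ∘ realEmbed d) :=
  (ContDiff.restrict_scalars ℝ hF).comp (realEmbed d).contDiff

lemma IsEntire.hasFDerivAt_comp_realEmbed {F : (Fin d → ℂ) → ℂ} (hF : IsEntire F) (y : RSpace d) :
    HasFDerivAt (F ∘ realEmbed d)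
      (((fderiv ℂ F (realEmbed d y)).restrictScalars ℝ).comp (realEmbed d)) y :=
  ((hF.differentiable (realEmbed d y)).hasFDerivAt.restrictScalars ℝ).comp y
    (realEmbed d).hasFDerivAt

lemma partialDeriv_comp_realEmbed {F : (Fin d → ℂ) → ℂ} (hF : IsEntire F) (i : Fin d) :
    partialDeriv i (F ∘ realEmbed d) = complexPartial i F ∘ realEmbed d := by
  funext y
  have : realEmbed d (EuclideanSpace.single i 1) = Pi.single i 1 := by
    funext j
    simp [Pi.single_apply, apply_ite]
  simp [partialDeriv, complexPartial, (hF.hasFDerivAt_comp_realEmbed y).fderiv, this]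

lemma iterate_partialDeriv_comp_realEmbed {F : (Fin d → ℂ) → ℂ} (hF : IsEntire F) (i : Fin d)
    (n : ℕ) :
    (partialDeriv i)^[n] (F ∘ realEmbed d) = (complexPartial i)^[n] F ∘ realEmbed d := by
  induction n generalizing F with
  | zero => rfl
  | succ n ih =>
    rw [Function.iterate_succ_apply, Function.iterate_succ_apply,
      partialDeriv_comp_realEmbed hF, ih (hF.complexPartial i)]

lemma foldr_partialDeriv_comp_realEmbed {F : (Fin d → ℂ) → ℂ} (hF : IsEntire F) (β : Fin d → ℕ)
    (l : List (Fin d)) :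
    IsEntire (l.foldr (fun i g => (complexPartial i)^[β i] g) F) ∧
    l.foldr (fun i g => (partialDeriv i)^[β i] g) (F ∘ realEmbed d) =
      l.foldr (fun i g => (complexPartial i)^[β i] g) F ∘ realEmbed d := by
  induction l with
  | nil => exact ⟨hF, rfl⟩
  | cons i l ih =>
    simp only [List.foldr_cons]
    exact ⟨ih.1.iterate_complexPartial i _,
      by rw [ih.2, iterate_partialDeriv_comp_realEmbed ih.1]⟩

lemma IsEntire.iteratedDeriv_slice {F : (Fin d → ℂ) → ℂ} (hF : IsEntire F) (i : Fin d) (n : ℕ)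
    (z : Fin d → ℂ) :
    iteratedDeriv n (fun w : ℂ => F (z + Pi.single i w)) =
      fun w => (GelfandShilov.complexPartial i)^[n] F (z + Pi.single i w) := by
  induction n with
  | zero => simp
  | succ n ih =>
    rw [iteratedDeriv_succ, ih]
    funext w
    have hG := hF.iterate_complexPartial i n
    have hL : HasDerivAt (fun w : ℂ => z + Pi.single i w) (Pi.single i (1 : ℂ)) w :=
      ((ContinuousLinearMap.single ℂ (fun _ : Fin d => ℂ) i).hasDerivAt (x := w)).const_add z
    have := (hG.differentiable (z + Pi.single i w)).hasFDerivAt.comp_hasDerivAt w hL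
    rw [Function.iterate_succ_apply']
    exact this.deriv

lemma IsEntire.norm_iterate_complexPartial_le {F : (Fin d → ℂ) → ℂ} (hF : IsEntire F) (i : Fin d)
    (n : ℕ) {z : Fin d → ℂ} {r M : ℝ} (hr : 0 < r)
    (h : ∀ w : ℂ, ‖w‖ = r → ‖F (z + Pi.single i w)‖ ≤ M) :
    ‖(GelfandShilov.complexPartial i)^[n] F z‖ ≤ n.factorial / r ^ n * M := by
  have hd : Differentiable ℂ (fun w : ℂ => F (z + Pi.single i w)) :=
    hF.differentiable.comp ((differentiable_const z).add
      (ContinuousLinearMap.single ℂ (fun _ : Fin d => ℂ) i).differentiable)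
  have := Complex.norm_iteratedDeriv_le_of_forall_mem_sphere_norm_le (c := 0) n hr
    hd.diffContOnCl (C := M) (fun w hw => h w (by simpa using hw))
  rw [hF.iteratedDeriv_slice] at this
  simp only [Pi.single_zero, add_zero] at this
  calc _ ≤ _ := this
    _ = _ := by ring

/-- One-variable Cauchy estimates, one coordinate of the list at a time. As the list has no
repetitions and `w` vanishes off it, each coordinate is displaced only once, so the points stay in
the polydisc of radii `r`. -/
lemma IsEntire.norm_foldr_complexPartial_le {F : (Fin d → ℂ) → ℂ} (hF : IsEntire F)
    (β : Fin d → ℕ) {r : Fin d → ℝ} (hr : ∀ i, 0 < r i) {M : ℝ} (l : List (Fin d)) (hl : l.Nodup)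
    (z : Fin d → ℂ)
    (h : ∀ w : Fin d → ℂ, (∀ i, ‖w i‖ ≤ r i) → (∀ i, i ∉ l → w i = 0) → ‖F (z + w)‖ ≤ M) :
    ‖l.foldr (fun i g => (GelfandShilov.complexPartial i)^[β i] g) F z‖ ≤
      (l.map fun i => ((β i).factorial : ℝ) / r i ^ β i).prod * M := by
  induction l generalizing z with
  | nil => simpa using h 0 (by simp [fun i => (hr i).le]) (by simp)
  | cons i l ih =>
    rw [List.nodup_cons] at hl
    simp only [List.foldr_cons, List.map_cons, List.prod_cons]
    rw [mul_assoc]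
    refine (foldr_partialDeriv_comp_realEmbed hF β l).1.norm_iterate_complexPartial_le i _ (hr i)
      fun w hw => ih hl.2 _ fun w' hw' hw'' => ?_
    rw [add_assoc]
    refine h _ (fun k => ?_) (fun k hk => ?_)
    · rcases eq_or_ne k i with rfl | hki
      · simp [hw'' k hl.1, hw]
      · simpa [hki] using hw' k
    · simp only [List.mem_cons, not_or] at hk
      simp [hk.1, hw'' k hk.2]

/-! ### From Gaussian bounds on `ℂ^d` to Gelfand-Shilov norms. -/

lemma gsWeight_eq_prod {θ C : ℝ} (α β : Fin d → ℕ) :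
    gsWeight θ C α β = ∏ i, (C ^ α i * ((α i).factorial : ℝ) ^ θ)
      * (C ^ β i * ((β i).factorial : ℝ) ^ θ) := by
  have h : ∀ γ : Fin d → ℕ,
      ((multiFactorial γ : ℕ) : ℝ) ^ θ = ∏ i, ((γ i).factorial : ℝ) ^ θ := fun γ => by
    rw [multiFactorial, Nat.cast_prod, Real.finsetProd_rpow _ _ (fun i _ => by positivity)]
  simp only [gsWeight, h, multiLength, pow_add, ← Finset.prod_pow_eq_pow_sum,
    Finset.prod_mul_distrib]
  ring

/-- Gaussian-type bounds in a complex neighbourhood of `ℝ^d` yield Gelfand-Shilov bounds. -/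
lemma exists_gsNorm_comp_realEmbed_le {θ c D δ : ℝ} (hθ : 1 / 2 ≤ θ) (hθ' : θ < 1) (hc : 0 < c)
    (hD : 0 ≤ D) (hδ : 0 < δ) :
    ∃ C : ℝ, 0 < C ∧ ∃ K : ℝ, 0 < K ∧ ∀ (F : (Fin d → ℂ) → ℂ) (x : RSpace d) (s : Fin d → ℝ)
      (M : ℝ), IsEntire F → 0 ≤ M → (∀ j, 0 ≤ s j) →
      (∀ (y : RSpace d) (w : Fin d → ℂ), ‖F (realEmbed d y + w)‖ ≤
        M * Real.exp (-c * ‖y - x‖ ^ 2 + ∑ j, (s j * ‖w j‖ + D * ‖w j‖ ^ 2))) →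
      gsNorm θ C (F ∘ realEmbed d) ≤
        ENNReal.ofReal (M * K * Real.exp (δ * ∑ j, (|x j| ^ (1 / θ) + s j ^ (1 / θ)))) := by
  have hθ0 : 0 < θ := by linarith
  have hq : 0 ≤ 1 / θ := by positivity
  have hq' : 1 / θ ≤ 2 := by rw [div_le_iff₀ hθ0]; linarith
  obtain ⟨E, hE, hEb⟩ := exists_cauchy_factor_le hθ hθ' hδ hD
  -- The factors `4` are those of `abs_rpow_le_shift`: the shifted term must fit into `δ |x
  -- j|^{1/θ}` and the quadratic one into the Gaussian.
  set δ₀ := min (δ / 4) (c / 4) with hδ₀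
  have hδ₀p : 0 < δ₀ := by positivity
  have hδ₀1 : 4 * δ₀ ≤ δ := by linarith [min_le_left (δ / 4) (c / 4)]
  have hδ₀2 : 4 * δ₀ ≤ c := by linarith [min_le_right (δ / 4) (c / 4)]
  set C₁ := (θ / δ₀) ^ θ with hC₁
  set C := max C₁ (Real.exp E) with hCdef
  have hC0 : 0 < C := lt_max_of_lt_right (Real.exp_pos E)
  refine ⟨C, hC0, ∏ _i : Fin d, Real.exp (c + E), by positivity, ?_⟩
  intro F x s M hF hM hs h
  refine iSup_le fun α => iSup_le fun β => iSup_le fun y => ENNReal.ofReal_le_ofReal ?_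
  rw [div_le_iff₀ (gsWeight_pos hC0 α β)]
  -- The polydisc has its own radius in each coordinate, adapted to the order `β j` of that
  -- derivative.
  have hder : ‖multiDeriv β (F ∘ realEmbed d) y‖ ≤
      (∏ j, ((β j).factorial : ℝ) / cauchyRadius θ (β j) ^ β j) *
        (M * Real.exp (-c * ‖y - x‖ ^ 2 +
          ∑ j, (s j * cauchyRadius θ (β j) + D * cauchyRadius θ (β j) ^ 2))) := by
    rw [multiDeriv, (foldr_partialDeriv_comp_realEmbed hF β _).2]
    have := hF.norm_foldr_complexPartial_le β (r := fun j => cauchyRadius θ (β j))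
      (fun j => cauchyRadius_pos θ _) (M := M * Real.exp (-c * ‖y - x‖ ^ 2 +
          ∑ j, (s j * cauchyRadius θ (β j) + D * cauchyRadius θ (β j) ^ 2)))
      (List.finRange d) (List.nodup_finRange d) (realEmbed d y) (fun w hw _ => by
        refine (h y w).trans ?_
        gcongr with j
        · exact hs j
        · exact hw j
        · exact hw j)
    rw [← List.ofFn_eq_map, List.prod_ofFn] at this
    exact this
  -- Everything factorises over coordinates. The power of `y j` is paid by the Gaussian, the
  -- derivative by the Cauchy radius.
  have hone : ∀ j, |y j| ^ α j * Real.exp (-c * (y j - x j) ^ 2) *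
      (((β j).factorial : ℝ) / cauchyRadius θ (β j) ^ β j *
        Real.exp (s j * cauchyRadius θ (β j) + D * cauchyRadius θ (β j) ^ 2)) ≤
      (C ^ α j * ((α j).factorial : ℝ) ^ θ * Real.exp (δ * |x j| ^ (1 / θ) + c)) *
        (Real.exp E * C ^ β j * ((β j).factorial : ℝ) ^ θ * Real.exp (δ * s j ^ (1 / θ))) := by
    intro j
    have h1 := pow_le_factorial_rpow_mul_exp hθ0 hδ₀p (abs_nonneg (y j)) (α j)
    have h2 := abs_rpow_le_shift hq hq' (y j) (x j)
    have h3 : δ₀ * |y j| ^ (1 / θ) ≤ δ * |x j| ^ (1 / θ) + c * (y j - x j) ^ 2 + c := by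
      have a1 : δ₀ * |y j| ^ (1 / θ) ≤ δ₀ * (4 * |x j| ^ (1 / θ) + 4 * (y j - x j) ^ 2 + 4) := by
        gcongr
      have a2 : 4 * δ₀ * |x j| ^ (1 / θ) ≤ δ * |x j| ^ (1 / θ) := by gcongr
      have a3 : 4 * δ₀ * (y j - x j) ^ 2 ≤ c * (y j - x j) ^ 2 := by gcongr
      linarith
    have hr := cauchyRadius_pos θ (β j)
    refine mul_le_mul ?_ ?_ (by positivity) (by positivity)
    · calc |y j| ^ α j * Real.exp (-c * (y j - x j) ^ 2)
          ≤ (C ^ α j * ((α j).factorial : ℝ) ^ θ *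
              Real.exp (δ * |x j| ^ (1 / θ) + c * (y j - x j) ^ 2 + c)) *
              Real.exp (-c * (y j - x j) ^ 2) := by
            gcongr
            refine h1.trans ?_
            gcongr
            exact le_max_left _ _
        _ = C ^ α j * ((α j).factorial : ℝ) ^ θ * (Real.exp
              (δ * |x j| ^ (1 / θ) + c * (y j - x j) ^ 2 + c) *
              Real.exp (-c * (y j - x j) ^ 2)) := by ring
        _ = _ := by rw [← Real.exp_add]; congr 2; ring
    · refine (hEb (β j) (s j) (hs j)).trans ?_
      gcongr
      exact le_max_right _ _
  have hprod := Finset.prod_le_prod (s := Finset.univ) (fun j _ => by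
    have hr := cauchyRadius_pos θ (β j)
    positivity) (fun j _ => hone j)
  have hnorm : ‖y - x‖ ^ 2 = ∑ j, (y j - x j) ^ 2 := by
    rw [EuclideanSpace.real_norm_sq_eq]; rfl
  calc |monomial α y| * ‖multiDeriv β (F ∘ realEmbed d) y‖
      ≤ (∏ j, |y j| ^ α j) * ((∏ j, ((β j).factorial : ℝ) / cauchyRadius θ (β j) ^ β j) *
        (M * Real.exp (-c * ‖y - x‖ ^ 2 +
          ∑ j, (s j * cauchyRadius θ (β j) + D * cauchyRadius θ (β j) ^ 2)))) := by
        have : |monomial α y| = ∏ j, |y j| ^ α j := by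
          simp [monomial, Finset.abs_prod, abs_pow]
        rw [this]
        gcongr
    _ = M * ∏ j, (|y j| ^ α j * Real.exp (-c * (y j - x j) ^ 2) *
      (((β j).factorial : ℝ) / cauchyRadius θ (β j) ^ β j *
        Real.exp (s j * cauchyRadius θ (β j) + D * cauchyRadius θ (β j) ^ 2))) := by
        rw [hnorm, Real.exp_add, Finset.mul_sum, Real.exp_sum, Real.exp_sum]
        simp only [Finset.prod_mul_distrib]
        ring
    _ ≤ M * ∏ j, ((C ^ α j * ((α j).factorial : ℝ) ^ θ * Real.exp (δ * |x j| ^ (1 / θ) + c)) *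
        (Real.exp E * C ^ β j * ((β j).factorial : ℝ) ^ θ * Real.exp (δ * s j ^ (1 / θ)))) := by
        gcongr
    _ = _ := by
        rw [gsWeight_eq_prod, Finset.mul_sum, Real.exp_sum]
        simp only [mul_add δ, Real.exp_add, Finset.prod_mul_distrib]
        ring

/-- Derivatives in one direction of an entire function with Gaussian bounds. -/
lemma exists_norm_iterate_partialDeriv_le {θ c D : ℝ} (hθ : 1 / 2 ≤ θ) (hθ' : θ < 1)
    (hD : 0 ≤ D) :
    ∃ C : ℝ, 1 ≤ C ∧ ∀ (F : (Fin d → ℂ) → ℂ) (x : RSpace d) (M : ℝ), IsEntire F → 0 ≤ M →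
      (∀ (y : RSpace d) (w : Fin d → ℂ), ‖F (realEmbed d y + w)‖ ≤
        M * Real.exp (-c * ‖y - x‖ ^ 2 + ∑ j, D * ‖w j‖ ^ 2)) →
      ∀ (j : Fin d) (n : ℕ) (y : RSpace d), ‖(partialDeriv j)^[n] (F ∘ realEmbed d) y‖ ≤
        M * C * C ^ n * (n.factorial : ℝ) ^ θ * Real.exp (-c * ‖y - x‖ ^ 2) := by
  have hθ0 : 0 < θ := by linarith
  obtain ⟨E, hE, hEb⟩ := exists_cauchy_factor_le hθ hθ' one_pos hD
  refine ⟨Real.exp E, Real.one_le_exp hE, fun F x M hF hM h j n y => ?_⟩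
  rw [iterate_partialDeriv_comp_realEmbed hF]
  have h1 := hF.norm_iterate_complexPartial_le j n (z := realEmbed d y) (cauchyRadius_pos θ n)
    (M := M * Real.exp (-c * ‖y - x‖ ^ 2 + D * cauchyRadius θ n ^ 2)) (fun w hw => by
      refine (h y _).trans (le_of_eq ?_)
      rw [Finset.sum_eq_single j (fun k _ hk => by simp [hk]) (by simp)]
      simp [hw])
  refine h1.trans ?_
  -- Without a linear term in the exponent one takes `s = 0`, and the exponential loss disappears.
  have h2 := hEb n 0 le_rfl
  rw [Real.zero_rpow (by positivity), zero_mul, zero_add, mul_zero, Real.exp_zero, mul_one] at h2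
  calc _ = (n.factorial / cauchyRadius θ n ^ n * Real.exp (D * cauchyRadius θ n ^ 2)) *
        (M * Real.exp (-c * ‖y - x‖ ^ 2)) := by rw [Real.exp_add]; ring
    _ ≤ (Real.exp E * Real.exp E ^ n * (n.factorial : ℝ) ^ θ) *
        (M * Real.exp (-c * ‖y - x‖ ^ 2)) := by gcongr
    _ = _ := by ring

/-! ### Complex quadratic forms and Gaussian wave packets. -/

/-- Weighted arithmetic-geometric mean; the free `ε` later makes cross terms small against a
definite form. -/
lemma norm_mulVec_dotProduct_le (M : Matrix (Fin d) (Fin d) ℂ) (a b : Fin d → ℂ) {ε : ℝ}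
    (hε : 0 < ε) :
    ‖(M *ᵥ a) ⬝ᵥ b‖ ≤
      (∑ i, ∑ j, ‖M i j‖) * (ε * ∑ j, ‖a j‖ ^ 2 + ε⁻¹ * ∑ j, ‖b j‖ ^ 2) := by
  have h1 : (M *ᵥ a) ⬝ᵥ b = ∑ i, ∑ j, M i j * a j * b i := by
    simp [dotProduct, Matrix.mulVec, Finset.sum_mul]
  rw [h1, Finset.sum_mul]
  refine (norm_sum_le _ _).trans (Finset.sum_le_sum fun i _ => ?_)
  rw [Finset.sum_mul]
  refine (norm_sum_le _ _).trans (Finset.sum_le_sum fun j _ => ?_)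
  rw [norm_mul, norm_mul, mul_assoc]
  gcongr
  have ha : ‖a j‖ ^ 2 ≤ ∑ j, ‖a j‖ ^ 2 :=
    Finset.single_le_sum (f := fun j => ‖a j‖ ^ 2) (fun _ _ => by positivity) (Finset.mem_univ j)
  have hb : ‖b i‖ ^ 2 ≤ ∑ j, ‖b j‖ ^ 2 :=
    Finset.single_le_sum (f := fun j => ‖b j‖ ^ 2) (fun _ _ => by positivity) (Finset.mem_univ i)
  calc ‖a j‖ * ‖b i‖ ≤ ε * ‖a j‖ ^ 2 + ε⁻¹ * ‖b i‖ ^ 2 := by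
        have h := sq_nonneg (ε * ‖a j‖ - ‖b i‖)
        have h0 : 0 ≤ ε * (‖a j‖ * ‖b i‖) := by positivity
        have h2 : ε * (‖a j‖ * ‖b i‖) ≤ ε * (ε * ‖a j‖ ^ 2 + ε⁻¹ * ‖b i‖ ^ 2) := by
          rw [mul_add, ← mul_assoc ε ε⁻¹, mul_inv_cancel₀ hε.ne']
          nlinarith
        exact le_of_mul_le_mul_left h2 hε
    _ ≤ _ := by gcongr

lemma exists_posDef_lower_bound {P : Matrix (Fin d) (Fin d) ℝ} (hP : P.PosDef) :
    ∃ c : ℝ, 0 < c ∧ ∀ t : RSpace d, c * ‖t‖ ^ 2 ≤ (P *ᵥ t.ofLp) ⬝ᵥ t.ofLp := by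
  have hcont : Continuous fun t : RSpace d => (P *ᵥ t.ofLp) ⬝ᵥ t.ofLp := by
    simp only [dotProduct, Matrix.mulVec]
    fun_prop
  have hpos : ∀ t : RSpace d, t ≠ 0 → 0 < (P *ᵥ t.ofLp) ⬝ᵥ t.ofLp := by
    intro t ht
    have := hP.dotProduct_mulVec_pos (x := t.ofLp) (by simpa using ht)
    rwa [star_trivial, dotProduct_comm] at this
  -- The sphere is empty only in dimension zero, where any constant works; otherwise the minimum on
  -- the sphere extends by homogeneity.
  rcases (Metric.sphere (0 : RSpace d) 1).eq_empty_or_nonempty with he | hne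
  · refine ⟨1, one_pos, fun t => ?_⟩
    have : t = 0 := by
      by_contra h
      have : ‖t‖⁻¹ • t ∈ Metric.sphere (0 : RSpace d) 1 := by
        simp [norm_smul, h]
      rw [he] at this
      exact this
    simp [this]
  · obtain ⟨t₀, ht₀, hmin⟩ := (isCompact_sphere (0 : RSpace d) 1).exists_isMinOn hne
      hcont.continuousOn
    have ht₀0 : t₀ ≠ 0 := by rintro rfl; simp at ht₀
    refine ⟨_, hpos t₀ ht₀0, fun t => ?_⟩
    rcases eq_or_ne t 0 with rfl | ht
    · simp
    have hmem : ‖t‖⁻¹ • t ∈ Metric.sphere (0 : RSpace d) 1 := by simp [norm_smul, ht]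
    have h1 := hmin hmem
    simp only [Set.mem_ofPred_eq, WithLp.ofLp_smul, Matrix.mulVec_smul, smul_dotProduct,
      dotProduct_smul, smul_eq_mul] at h1
    have ht' : 0 < ‖t‖ := norm_pos_iff.2 ht
    calc _ ≤ (‖t‖⁻¹ * (‖t‖⁻¹ * (P *ᵥ t.ofLp ⬝ᵥ t.ofLp))) * ‖t‖ ^ 2 := by gcongr
      _ = _ := by field_simp

lemma im_mulVec_dotProduct_realEmbed (M : Matrix (Fin d) (Fin d) ℂ) (t : RSpace d) :
    ((M *ᵥ realEmbed d t) ⬝ᵥ realEmbed d t).im = ((M.map Complex.im) *ᵥ t.ofLp) ⬝ᵥ t.ofLp := by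
  simp [dotProduct, Matrix.mulVec]

lemma exists_im_quadratic_lower_bound {M : Matrix (Fin d) (Fin d) ℂ}
    (hP : (M.map Complex.im).PosDef) :
    ∃ c : ℝ, 0 < c ∧ ∃ D : ℝ, 0 ≤ D ∧ ∀ (t : RSpace d) (w : Fin d → ℂ),
      c * ‖t‖ ^ 2 - D * ∑ j, ‖w j‖ ^ 2 ≤
        ((1 / 2 : ℂ) * ((M *ᵥ (realEmbed d t + w)) ⬝ᵥ (realEmbed d t + w))).im := by
  obtain ⟨c₀, hc₀, hb⟩ := exists_posDef_lower_bound hP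
  set L := ∑ i, ∑ j, ‖M i j‖ with hL
  have hL0 : 0 ≤ L := by positivity
  -- Small enough that the two cross terms together cost at most half of `c₀ ‖t‖²`; their remainders
  -- go into `D`.
  set ε := c₀ / (4 * (L + 1)) with hε
  have hε0 : 0 < ε := by positivity
  have hεL : 2 * (L * ε) ≤ c₀ / 2 := by
    rw [hε]
    have : L * (c₀ / (4 * (L + 1))) ≤ c₀ / 4 := by
      rw [mul_div_assoc', div_le_div_iff₀ (by positivity) (by positivity)]
      nlinarith
    linarith
  refine ⟨c₀ / 4, by positivity, (2 * (L * ε⁻¹) + 2 * L) / 2, by positivity, fun t w => ?_⟩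
  have hS : ∑ j, ‖realEmbed d t j‖ ^ 2 = ‖t‖ ^ 2 := by
    rw [EuclideanSpace.norm_sq_eq]; simp
  have h1 := norm_mulVec_dotProduct_le M (realEmbed d t) w hε0
  have h2 := norm_mulVec_dotProduct_le M w (realEmbed d t) (inv_pos.2 hε0)
  have h3 := norm_mulVec_dotProduct_le M w w one_pos
  have h4 := hb t
  rw [← im_mulVec_dotProduct_realEmbed] at h4
  rw [hS, ← hL] at h1
  rw [hS, ← hL, inv_inv] at h2
  rw [← hL, inv_one, one_mul] at h3
  set W := ∑ j, ‖w j‖ ^ 2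
  have e : ((1 / 2 : ℂ) * ((M *ᵥ (realEmbed d t + w)) ⬝ᵥ (realEmbed d t + w))).im =
      (((M *ᵥ realEmbed d t) ⬝ᵥ realEmbed d t).im + ((M *ᵥ realEmbed d t) ⬝ᵥ w).im
        + ((M *ᵥ w) ⬝ᵥ realEmbed d t).im + ((M *ᵥ w) ⬝ᵥ w).im) / 2 := by
    rw [Matrix.mulVec_add, add_dotProduct, dotProduct_add, dotProduct_add]
    have : (1 / 2 : ℂ) = ((1 / 2 : ℝ) : ℂ) := by push_cast; rfl
    rw [this, Complex.im_ofReal_mul]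
    simp only [Complex.add_im]
    ring
  rw [e]
  have i1 := neg_abs_le ((M *ᵥ realEmbed d t) ⬝ᵥ w).im
  have i2 := neg_abs_le ((M *ᵥ w) ⬝ᵥ realEmbed d t).im
  have i3 := neg_abs_le ((M *ᵥ w) ⬝ᵥ w).im
  have j1 := Complex.abs_im_le_norm ((M *ᵥ realEmbed d t) ⬝ᵥ w)
  have j2 := Complex.abs_im_le_norm ((M *ᵥ w) ⬝ᵥ realEmbed d t)
  have j3 := Complex.abs_im_le_norm ((M *ᵥ w) ⬝ᵥ w)
  have k : 2 * (L * ε) * ‖t‖ ^ 2 ≤ c₀ / 2 * ‖t‖ ^ 2 := by gcongr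
  linarith

/-- The holomorphic extension of the Gaussian wave packet centred at `(x, 2πη)`, up to sign. -/
noncomputable def packetExt (M : Matrix (Fin d) (Fin d) ℂ) (p : RSpace d × RSpace d)
    (z : Fin d → ℂ) : ℂ :=
  Complex.exp (Complex.I * (-(2 * Real.pi) * (realEmbed d p.2 ⬝ᵥ z)
    + (1 / 2 : ℂ) * ((M *ᵥ (z - realEmbed d p.1)) ⬝ᵥ (z - realEmbed d p.1))))

/-- The Gaussian wave packet `e^{-2πi⟨η, y⟩ + (i/2)⟨M(y-x), y-x⟩}`, where `p = (x, η)`. -/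
noncomputable def packet (M : Matrix (Fin d) (Fin d) ℂ) (p : RSpace d × RSpace d) :
    RSpace d → ℂ :=
  packetExt M p ∘ realEmbed d

lemma isEntire_packetExt (M : Matrix (Fin d) (Fin d) ℂ) (p : RSpace d × RSpace d) :
    IsEntire (packetExt M p) := by
  unfold IsEntire packetExt
  simp only [dotProduct, Matrix.mulVec]
  fun_prop

lemma continuous_packet_uncurry (M : Matrix (Fin d) (Fin d) ℂ) :
    Continuous fun a : (RSpace d × RSpace d) × RSpace d => packet M a.1 a.2 := by
  unfold packet packetExt
  simp only [dotProduct, Matrix.mulVec, Function.comp_apply]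
  fun_prop

lemma contDiff_packet (M : Matrix (Fin d) (Fin d) ℂ) (p : RSpace d × RSpace d) :
    ContDiff ℝ ((⊤ : ℕ∞) : WithTop ℕ∞) (packet M p) :=
  (isEntire_packetExt M p).contDiff_comp_realEmbed

/-- The Gaussian decays in real directions because `Im M > 0`, while the character grows only
through the imaginary part of `w`, at rate `2π|η j|` in coordinate `j`. -/
lemma exists_norm_packetExt_le {M : Matrix (Fin d) (Fin d) ℂ} (hP : (M.map Complex.im).PosDef) :
    ∃ c : ℝ, 0 < c ∧ ∃ D : ℝ, 0 ≤ D ∧ ∀ (p : RSpace d × RSpace d) (y : RSpace d)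
      (w : Fin d → ℂ), ‖packetExt M p (realEmbed d y + w)‖ ≤
        Real.exp (-c * ‖y - p.1‖ ^ 2 +
          ∑ j, (2 * Real.pi * |p.2 j| * ‖w j‖ + D * ‖w j‖ ^ 2)) := by
  obtain ⟨c, hc, D, hD, h⟩ := exists_im_quadratic_lower_bound hP
  refine ⟨c, hc, D, hD, fun p y w => ?_⟩
  rw [packetExt, Complex.norm_exp, Complex.I_mul_re, Real.exp_le_exp, Complex.add_im]
  have h1 := h (y - p.1) w
  have e : realEmbed d y + w - realEmbed d p.1 = realEmbed d (y - p.1) + w := by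
    rw [map_sub]; abel
  rw [e]
  have h2 : (-(2 * (Real.pi : ℂ)) * (realEmbed d p.2 ⬝ᵥ (realEmbed d y + w))).im =
      -(2 * Real.pi) * ∑ j, p.2 j * (w j).im := by
    have : (-(2 * (Real.pi : ℂ))) = ((-(2 * Real.pi) : ℝ) : ℂ) := by push_cast; ring
    rw [this, Complex.im_ofReal_mul]
    simp [dotProduct]
  rw [h2, Finset.sum_add_distrib, ← Finset.mul_sum]
  have h3 : 2 * Real.pi * ∑ j, p.2 j * (w j).im ≤ ∑ j, 2 * Real.pi * |p.2 j| * ‖w j‖ := by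
    rw [Finset.mul_sum]
    refine Finset.sum_le_sum fun j _ => ?_
    have h4 : p.2 j * (w j).im ≤ |p.2 j| * ‖w j‖ := by
      refine (le_abs_self _).trans ?_
      rw [abs_mul]
      gcongr
      exact Complex.abs_im_le_norm _
    calc 2 * Real.pi * (p.2 j * (w j).im) ≤ 2 * Real.pi * (|p.2 j| * ‖w j‖) := by gcongr
      _ = _ := by ring
  linarith

lemma exists_norm_packet_le {M : Matrix (Fin d) (Fin d) ℂ} (hP : (M.map Complex.im).PosDef) :
    ∃ c : ℝ, 0 < c ∧ ∀ (p : RSpace d × RSpace d) (y : RSpace d),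
      ‖packet M p y‖ ≤ Real.exp (-c * ‖y - p.1‖ ^ 2) := by
  obtain ⟨c, hc, D, hD, h⟩ := exists_norm_packetExt_le hP
  refine ⟨c, hc, fun p y => ?_⟩
  simpa [packet] using h p y (0 : Fin d → ℂ)

/-- By symmetry of `M` the quadratic parts in `z` cancel, so a change of base point multiplies the
packet by the exponential of an affine function, which vanishes identically at `p = p₀`. -/
lemma packetExt_eq_mul {M : Matrix (Fin d) (Fin d) ℂ} (hM : M.IsSymm)
    (p p₀ : RSpace d × RSpace d) (z : Fin d → ℂ) :
    packetExt M p z = packetExt M p₀ z * Complex.exp (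
      ((-(2 * Real.pi) * Complex.I) • realEmbed d (p.2 - p₀.2)
        - Complex.I • (M *ᵥ realEmbed d (p.1 - p₀.1))) ⬝ᵥ z +
      Complex.I / 2 * ((M *ᵥ realEmbed d p.1) ⬝ᵥ realEmbed d p.1 -
        (M *ᵥ realEmbed d p₀.1) ⬝ᵥ realEmbed d p₀.1)) := by
  have hsym : ∀ a b : Fin d → ℂ, (M *ᵥ a) ⬝ᵥ b = (M *ᵥ b) ⬝ᵥ a := fun a b => by
    rw [dotProduct_comm, Matrix.dotProduct_mulVec, ← Matrix.mulVec_transpose, hM.eq]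
  rw [packetExt, packetExt, ← Complex.exp_add]
  congr 1
  simp only [map_sub, Matrix.mulVec_sub, sub_dotProduct, dotProduct_sub, smul_dotProduct,
    smul_eq_mul, hsym z]
  ring

/-- Apply `|e^T - 1| ≤ |T| e^{|T|}` to the affine exponent `T`. The resulting growth in `|z j|` is
absorbed by half of the Gaussian and by the additional `2‖w j‖`. This yields continuity of the
packets in the Gelfand-Shilov norm. -/
lemma exists_norm_packetExt_sub_le {M : Matrix (Fin d) (Fin d) ℂ} (hM : M.IsSymm)
    (hP : (M.map Complex.im).PosDef) :
    ∃ c : ℝ, 0 < c ∧ ∃ D : ℝ, 0 ≤ D ∧ ∀ p₀ : RSpace d × RSpace d, ∃ A : ℝ, 0 ≤ A ∧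
      ∃ τ : RSpace d × RSpace d → ℝ, (∀ p, 0 ≤ τ p) ∧ Tendsto τ (𝓝 p₀) (𝓝 0) ∧
      ∀ p, τ p ≤ 1 → ∀ (y : RSpace d) (w : Fin d → ℂ),
      ‖packetExt M p (realEmbed d y + w) - packetExt M p₀ (realEmbed d y + w)‖ ≤
        τ p * A * Real.exp (-c * ‖y - p₀.1‖ ^ 2 +
          ∑ j, ((2 * Real.pi * |p₀.2 j| + 2) * ‖w j‖ + D * ‖w j‖ ^ 2)) := by
  obtain ⟨c, hc, D, hD, h⟩ := exists_norm_packetExt_le hP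
  refine ⟨c / 2, by positivity, D, hD, fun p₀ =>
    ⟨Real.exp (2 + ∑ j, (2 * |p₀.1 j| + 2 / c)), by positivity, ?_⟩⟩
  set a : RSpace d × RSpace d → Fin d → ℂ := fun p =>
    (-(2 * Real.pi) * Complex.I) • realEmbed d (p.2 - p₀.2)
        - Complex.I • (M *ᵥ realEmbed d (p.1 - p₀.1)) with ha
  set b : RSpace d × RSpace d → ℂ := fun p =>
    Complex.I / 2 * ((M *ᵥ realEmbed d p.1) ⬝ᵥ realEmbed d p.1 -
        (M *ᵥ realEmbed d p₀.1) ⬝ᵥ realEmbed d p₀.1) with hb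
  refine ⟨fun p => ‖a p‖ + ‖b p‖, fun p => by positivity, ?_, fun p hp y w => ?_⟩
  · have hcont : Continuous fun p => ‖a p‖ + ‖b p‖ := by
      simp only [ha, hb, dotProduct]
      have : Continuous fun v : Fin d → ℂ => M *ᵥ v := Continuous.matrix_mulVec continuous_const continuous_id
      fun_prop
    have := hcont.tendsto p₀
    simpa [ha, hb] using this
  set z := realEmbed d y + w with hz
  set N := ∑ j, ‖z j‖ with hN
  have hN0 : 0 ≤ N := by positivity
  rw [packetExt_eq_mul hM p p₀ z]
  set T := a p ⬝ᵥ z + b p with hT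
  have hT1 : ‖T‖ ≤ (‖a p‖ + ‖b p‖) * (1 + N) := by
    have : ‖a p ⬝ᵥ z‖ ≤ ‖a p‖ * N := by
      rw [dotProduct, hN, Finset.mul_sum]
      refine (norm_sum_le _ _).trans (Finset.sum_le_sum fun j _ => ?_)
      rw [norm_mul]
      gcongr
      exact norm_le_pi_norm (a p) j
    have h' := norm_add_le (a p ⬝ᵥ z) (b p)
    nlinarith [norm_nonneg (a p), norm_nonneg (b p)]
  have hT2 : ‖T‖ ≤ 1 + N := hT1.trans (mul_le_of_le_one_left (by positivity) hp)
  have hexp : ‖Complex.exp T - 1‖ ≤ (‖a p‖ + ‖b p‖) * Real.exp (2 + 2 * N) := by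
    have h1 := Complex.norm_exp_sub_sum_le_norm_mul_exp T 1
    simp only [Finset.range_one, Finset.sum_singleton, pow_zero, Nat.factorial_zero, Nat.cast_one,
      div_one, pow_one] at h1
    calc _ ≤ _ := h1
      _ ≤ (‖a p‖ + ‖b p‖) * (1 + N) * Real.exp (1 + N) := by gcongr
      _ ≤ (‖a p‖ + ‖b p‖) * Real.exp (1 + N) * Real.exp (1 + N) := by
        gcongr
        linarith [Real.add_one_le_exp (1 + N)]
      _ = _ := by rw [mul_assoc, ← Real.exp_add]; congr 2; ring
  have hNle : 2 * N ≤ ∑ j, (2 * |p₀.1 j| + 2 / c) + c / 2 * ‖y - p₀.1‖ ^ 2 + ∑ j, 2 * ‖w j‖ := by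
    have hnorm : ‖y - p₀.1‖ ^ 2 = ∑ j, (y j - p₀.1 j) ^ 2 := by
      rw [EuclideanSpace.real_norm_sq_eq]; rfl
    rw [hnorm, hN, Finset.mul_sum, Finset.mul_sum, ← Finset.sum_add_distrib,
      ← Finset.sum_add_distrib]
    refine Finset.sum_le_sum fun j _ => ?_
    have h1 : ‖z j‖ ≤ |y j| + ‖w j‖ := by
      have := norm_add_le (realEmbed d y j) (w j)
      simpa [hz] using this
    have h2 : |y j| ≤ |p₀.1 j| + |y j - p₀.1 j| := by
      have := abs_add_le (p₀.1 j) (y j - p₀.1 j)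
      simpa using this
    have h3 : 2 * |y j - p₀.1 j| ≤ c / 2 * (y j - p₀.1 j) ^ 2 + 2 / c := by
      rw [← sq_abs (y j - p₀.1 j)]
      set v := |y j - p₀.1 j|
      have : c / 2 * v ^ 2 + 2 / c - 2 * v = (c * v - 2) ^ 2 / (2 * c) := by field_simp; ring
      have : 0 ≤ (c * v - 2) ^ 2 / (2 * c) := by positivity
      linarith
    linarith
  have hk := h p₀ y w
  rw [← hz] at hk
  calc ‖packetExt M p₀ z * Complex.exp T - packetExt M p₀ z‖
      = ‖packetExt M p₀ z‖ * ‖Complex.exp T - 1‖ := by rw [← norm_mul]; congr 1; ring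
    _ ≤ Real.exp (-c * ‖y - p₀.1‖ ^ 2 +
          ∑ j, (2 * Real.pi * |p₀.2 j| * ‖w j‖ + D * ‖w j‖ ^ 2)) *
        ((‖a p‖ + ‖b p‖) * Real.exp (2 + 2 * N)) := by gcongr
    _ = (‖a p‖ + ‖b p‖) * Real.exp (-c * ‖y - p₀.1‖ ^ 2 +
          ∑ j, (2 * Real.pi * |p₀.2 j| * ‖w j‖ + D * ‖w j‖ ^ 2) + (2 + 2 * N)) := by
        rw [Real.exp_add _ (2 + 2 * N)]; ring
    _ ≤ (‖a p‖ + ‖b p‖) * Real.exp ((2 + ∑ j, (2 * |p₀.1 j| + 2 / c)) + (-(c / 2) * ‖y - p₀.1‖ ^ 2 +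
          ∑ j, ((2 * Real.pi * |p₀.2 j| + 2) * ‖w j‖ + D * ‖w j‖ ^ 2))) := by
        refine mul_le_mul_of_nonneg_left (Real.exp_le_exp.2 ?_) (by positivity)
        have e : ∑ j, ((2 * Real.pi * |p₀.2 j| + 2) * ‖w j‖ + D * ‖w j‖ ^ 2) =
            ∑ j, (2 * Real.pi * |p₀.2 j| * ‖w j‖ + D * ‖w j‖ ^ 2) + ∑ j, 2 * ‖w j‖ := by
          rw [← Finset.sum_add_distrib]
          exact Finset.sum_congr rfl fun j _ => by ring
        rw [e]
        linarith
    _ = _ := by rw [Real.exp_add]; ring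

/-- The norm parameter `C` may depend on the growth rate `δ`; this is harmless because an
ultradistribution is bounded by the norm with any parameter. -/
lemma exists_gsNorm_packet_le {θ δ : ℝ} (hθ : 1 / 2 ≤ θ) (hθ' : θ < 1) (hδ : 0 < δ)
    {M : Matrix (Fin d) (Fin d) ℂ} (hM : M.IsSymm) (hP : (M.map Complex.im).PosDef) :
    ∃ C : ℝ, 0 < C ∧ ∃ K : ℝ, 0 < K ∧
      (∀ p, gsNorm θ C (packet M p) ≤ ENNReal.ofReal (K * Real.exp (δ * ‖p‖ ^ (1 / θ)))) ∧
      ∀ p₀, Tendsto (fun p => gsNorm θ C (packet M p - packet M p₀)) (𝓝 p₀) (𝓝 0) := by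
  have hθ0 : 0 < θ := by linarith
  obtain ⟨c₁, hc₁, D₁, hD₁, h₁⟩ := exists_norm_packetExt_le hP
  obtain ⟨c₂, hc₂, D₂, hD₂, h₂⟩ := exists_norm_packetExt_sub_le hM hP
  set c := min c₁ c₂
  set D := max D₁ D₂
  -- `Λ` compares the sum over coordinates with `‖p‖^{1/θ}`; dividing `δ` by `Λ + 1` rather than `Λ`
  -- covers `d = 0`.
  set Λ : ℝ := d * (1 + (2 * Real.pi) ^ (1 / θ)) with hΛ
  have hΛ0 : 0 ≤ Λ := by positivity
  obtain ⟨C, hC, K, hK, hb⟩ := exists_gsNorm_comp_realEmbed_le (d := d) (c := c) (D := D)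
    (δ := δ / (Λ + 1)) hθ hθ' (lt_min hc₁ hc₂) (le_max_of_le_left hD₁) (by positivity)
  refine ⟨C, hC, K, hK, fun p => ?_, fun p₀ => ?_⟩
  · have := hb (packetExt M p) p.1 (fun j => 2 * Real.pi * |p.2 j|) 1 (isEntire_packetExt M p)
      zero_le_one (fun j => by positivity) (fun y w => (h₁ p y w).trans (by
        rw [one_mul]
        gcongr
        · exact min_le_left _ _
        · exact le_max_left _ _))
    refine this.trans (ENNReal.ofReal_le_ofReal ?_)
    rw [one_mul]
    refine mul_le_mul_of_nonneg_left (Real.exp_le_exp.2 ?_) hK.le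
    have hsum : ∑ j, (|p.1 j| ^ (1 / θ) + (2 * Real.pi * |p.2 j|) ^ (1 / θ))
        ≤ Λ * ‖p‖ ^ (1 / θ) := by
      have : ∀ j ∈ Finset.univ, |p.1 j| ^ (1 / θ) + (2 * Real.pi * |p.2 j|) ^ (1 / θ)
          ≤ (1 + (2 * Real.pi) ^ (1 / θ)) * ‖p‖ ^ (1 / θ) := fun j _ => by
        rw [add_mul, one_mul, ← Real.mul_rpow (by positivity) (norm_nonneg p)]
        gcongr
        · exact (PiLp.norm_apply_le p.1 j).trans (norm_fst_le p)
        · exact (PiLp.norm_apply_le p.2 j).trans (norm_snd_le p)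
      refine (Finset.sum_le_card_nsmul _ _ _ this).trans (le_of_eq ?_)
      simp [hΛ]
      ring
    calc δ / (Λ + 1) * _ ≤ δ / (Λ + 1) * (Λ * ‖p‖ ^ (1 / θ)) := by gcongr
      _ = (Λ / (Λ + 1)) * (δ * ‖p‖ ^ (1 / θ)) := by field_simp
      _ ≤ δ * ‖p‖ ^ (1 / θ) :=
        mul_le_of_le_one_left (by positivity) (by rw [div_le_one (by positivity)]; linarith)
  · obtain ⟨A, hA, τ, hτ, hτ0, hdiff⟩ := h₂ p₀
    set B := Real.exp (δ / (Λ + 1) *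
      ∑ j, (|p₀.1 j| ^ (1 / θ) + (2 * Real.pi * |p₀.2 j| + 2) ^ (1 / θ))) with hB
    have hlim : Tendsto (fun p => ENNReal.ofReal (τ p * A * K * B)) (𝓝 p₀) (𝓝 0) := by
      have : Tendsto (fun p => τ p * A * K * B) (𝓝 p₀) (𝓝 (0 * A * K * B)) :=
        ((hτ0.mul_const _).mul_const _).mul_const _
      have := ENNReal.tendsto_ofReal this
      simpa using this
    refine tendsto_of_tendsto_of_tendsto_of_le_of_le' tendsto_const_nhds hlim
      (Eventually.of_forall fun _ => zero_le) ?_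
    filter_upwards [hτ0.eventually (gt_mem_nhds one_pos)] with p hp
    exact hb (packetExt M p - packetExt M p₀) p₀.1 (fun j => 2 * Real.pi * |p₀.2 j| + 2) (τ p * A)
      (ContDiff.sub (isEntire_packetExt M p) (isEntire_packetExt M p₀))
      (mul_nonneg (hτ p) hA) (fun j => by positivity) (fun y w => (hdiff p hp.le y w).trans (by
        have := hτ p
        gcongr
        · exact min_le_right _ _
        · exact le_max_right _ _))

lemma memGS_packet {θ : ℝ} (hθ : 1 / 2 ≤ θ) (hθ' : θ < 1)
    {M : Matrix (Fin d) (Fin d) ℂ} (hM : M.IsSymm) (hP : (M.map Complex.im).PosDef)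
    (p : RSpace d × RSpace d) : packet M p ∈ GS d θ := by
  obtain ⟨C, hC, K, hK, h, -⟩ := exists_gsNorm_packet_le hθ hθ' one_pos hM hP
  exact ⟨contDiff_packet M p, C, hC, (h p).trans_lt ENNReal.ofReal_lt_top⟩

/-- At frequency zero the constants are uniform in the centre `x`; the frequency is split off as a
character by `packet_eq_mul_exp`. -/
lemma exists_norm_iterate_partialDeriv_packet_le {θ : ℝ} (hθ : 1 / 2 ≤ θ) (hθ' : θ < 1)
    {M : Matrix (Fin d) (Fin d) ℂ} (hP : (M.map Complex.im).PosDef) :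
    ∃ c : ℝ, 0 < c ∧ ∃ C : ℝ, 1 ≤ C ∧ ∀ (x : RSpace d) (j : Fin d) (n : ℕ) (y : RSpace d),
      ‖(partialDeriv j)^[n] (packet M (x, 0)) y‖ ≤
        C * C ^ n * (n.factorial : ℝ) ^ θ * Real.exp (-c * ‖y - x‖ ^ 2) := by
  obtain ⟨c, hc, D, hD, h⟩ := exists_norm_packetExt_le hP
  obtain ⟨C, hC, hb⟩ := exists_norm_iterate_partialDeriv_le (d := d) (c := c) hθ hθ' hD
  refine ⟨c, hc, C, hC, fun x j n y => ?_⟩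
  have := hb (packetExt M (x, 0)) x 1 (isEntire_packetExt M _) zero_le_one
    (fun y w => by simpa using h (x, 0) y w) j n y
  simpa [packet] using this

lemma packet_eq_mul_exp (M : Matrix (Fin d) (Fin d) ℂ) (x η y : RSpace d) :
    packet M (x, η) y =
      packet M (x, 0) y * Complex.exp (((-2 * Real.pi * inner ℝ y η : ℝ) : ℂ) * Complex.I) := by
  simp only [packet, packetExt, Function.comp_apply, ← Complex.exp_add]
  congr 1
  simp [dotProduct, PiLp.inner_apply]
  ring

/-! ### Integrability of the exponential weights. -/

section Integrability

lemma integrable_exp_neg_mul_norm_rpow {E : Type*} [NormedAddCommGroup E] [NormedSpace ℝ E]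
    [FiniteDimensional ℝ E] [MeasurableSpace E] [BorelSpace E] (μ : Measure E)
    [μ.IsAddHaarMeasure] {a q : ℝ} (ha : 0 < a) (hq : 1 ≤ q) :
    Integrable (fun p : E => Real.exp (-a * ‖p‖ ^ q)) μ := by
  set n := Module.finrank ℝ E + 1 with hn
  have h := (integrable_one_add_norm (E := E) (μ := μ) (r := n) (by rw [hn]; push_cast; linarith))
  refine (h.const_mul (n.factorial / a ^ n * Real.exp (2 * a))).mono' (by
    have : Continuous fun p : E => Real.exp (-a * ‖p‖ ^ q) := by
      have : Continuous fun p : E => ‖p‖ ^ q :=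
        continuous_norm.rpow_const fun _ => Or.inr (by linarith)
      fun_prop
    exact this.aestronglyMeasurable) (ae_of_all _ fun p => ?_)
  rw [Real.norm_of_nonneg (Real.exp_pos _).le, Real.rpow_neg (by positivity), Real.rpow_natCast]
  set t := ‖p‖ with ht
  have ht0 : 0 ≤ t := norm_nonneg p
  have h1 := le_one_add_rpow hq ht0
  have h2 := Real.pow_div_factorial_le_exp (a * (1 + t)) (by positivity) n
  have hf : (0 : ℝ) < n.factorial := by positivity
  have h3 : Real.exp (-a * t ^ q) ≤ Real.exp (2 * a) * (Real.exp (a * (1 + t)))⁻¹ := by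
    rw [← Real.exp_neg, ← Real.exp_add, Real.exp_le_exp]
    nlinarith
  have h4 : (Real.exp (a * (1 + t)))⁻¹ ≤ n.factorial / a ^ n * ((1 + t) ^ n)⁻¹ := by
    rw [mul_pow] at h2
    calc (Real.exp (a * (1 + t)))⁻¹ ≤ (a ^ n * (1 + t) ^ n / n.factorial)⁻¹ := by
          gcongr
      _ = _ := by rw [inv_div]; field_simp
  calc _ ≤ _ := h3
    _ ≤ Real.exp (2 * a) * (n.factorial / a ^ n * ((1 + t) ^ n)⁻¹) := by gcongr
    _ = _ := by ring

/-- Beyond `t₀`, where `t^{q-1}` reaches `A/ε`, the power dominates the linear term; before it the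
linear term is bounded. -/
lemma exists_mul_le_mul_rpow_add {q ε A : ℝ} (hq : 1 < q) (hε : 0 < ε) (hA : 0 ≤ A) :
    ∃ B : ℝ, ∀ t : ℝ, 0 ≤ t → A * t ≤ ε * t ^ q + B := by
  set t₀ := (A / ε) ^ (1 / (q - 1)) with ht₀
  have hq1 : 0 < q - 1 := by linarith
  have ht₀0 : 0 ≤ t₀ := by positivity
  refine ⟨A * t₀, fun t ht => ?_⟩
  rcases le_total t t₀ with h | h
  · have : A * t ≤ A * t₀ := by gcongr
    have : 0 ≤ ε * t ^ q := by positivity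
    linarith
  · have h1 : A / ε ≤ t ^ (q - 1) := by
      calc A / ε = t₀ ^ (q - 1) := by
            rw [ht₀, ← Real.rpow_mul (by positivity), one_div_mul_cancel hq1.ne', Real.rpow_one]
        _ ≤ _ := by gcongr
    have h2 : t ^ q = t ^ (q - 1) * t := by
      rcases ht.eq_or_lt with rfl | htp
      · rw [Real.zero_rpow (by linarith), mul_zero]
      · conv_rhs => rw [← Real.rpow_one t, ← Real.rpow_mul ht, ← Real.rpow_add htp]
        congr 1; ring
    rw [div_le_iff₀ hε] at h1
    have : A * t ≤ ε * t ^ q := by rw [h2]; nlinarith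
    have : 0 ≤ A * t₀ := by positivity
    linarith

end Integrability

/-! ### Differentiation under the integral sign for entire families. -/

section ParametricIntegral

variable {P : Type*} [MeasurableSpace P] {μ : Measure P}

/-- Families of entire functions, dominated on every complex strip around `ℝ^d` by an integrable
function of the parameter. -/
structure IsDominatedFamily (μ : Measure P) (H : P → (Fin d → ℂ) → ℂ) : Prop where
  entire : ∀ p, IsEntire (H p)
  meas : ∀ z, AEStronglyMeasurable (fun p => H p z) μ
  dom : ∀ R : ℝ, 0 ≤ R → ∃ b : P → ℝ, Integrable b μ ∧ ∀ p (y : RSpace d) (w : Fin d → ℂ),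
    (∀ i, ‖w i‖ ≤ R) → ‖H p (realEmbed d y + w)‖ ≤ b p

lemma IsDominatedFamily.exists_bound {H : P → (Fin d → ℂ) → ℂ} (hH : IsDominatedFamily μ H) :
    ∃ b : P → ℝ, Integrable b μ ∧ ∀ p (y : RSpace d), ‖H p (realEmbed d y)‖ ≤ b p := by
  obtain ⟨b, hb, h⟩ := hH.dom 0 le_rfl
  exact ⟨b, hb, fun p y => by simpa using h p y (0 : Fin d → ℂ) (by simp)⟩

lemma IsDominatedFamily.integrable {H : P → (Fin d → ℂ) → ℂ} (hH : IsDominatedFamily μ H)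
    (y : RSpace d) : Integrable (fun p => H p (realEmbed d y)) μ := by
  obtain ⟨b, hb, h⟩ := hH.exists_bound
  exact hb.mono' (hH.meas _) (ae_of_all _ fun p => h p y)

/-- Measurability: the derivative is a limit of difference quotients. Domination: Cauchy's estimate
on a unit circle widens the strip by one, which is why domination is required on strips of every
width. -/
lemma IsDominatedFamily.complexPartial {H : P → (Fin d → ℂ) → ℂ} (hH : IsDominatedFamily μ H)
    (i : Fin d) : IsDominatedFamily μ (fun p => GelfandShilov.complexPartial i (H p)) where
  entire p := (hH.entire p).complexPartial i
  meas z := by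
    have hlim : ∀ p, Tendsto (fun n : ℕ => ((n : ℂ) + 1) *
        (H p (z + Pi.single i ((n : ℂ) + 1)⁻¹) - H p z)) atTop
        (𝓝 (GelfandShilov.complexPartial i (H p) z)) := by
      intro p
      have hL : HasDerivAt (fun w : ℂ => z + Pi.single i w) (Pi.single i (1 : ℂ)) 0 :=
        ((ContinuousLinearMap.single ℂ (fun _ : Fin d => ℂ) i).hasDerivAt (x := 0)).const_add z
      have h1 : HasDerivAt (fun w : ℂ => H p (z + Pi.single i w))
          (GelfandShilov.complexPartial i (H p) z) 0 := by
        have h2 := ((hH.entire p).differentiable (z + Pi.single i 0)).hasFDerivAt.comp_hasDerivAt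
          (0 : ℂ) hL
        rw [Pi.single_zero, add_zero] at h2
        exact h2
      have h3 := hasDerivAt_iff_tendsto_slope_zero.1 h1
      have h4 : Tendsto (fun n : ℕ => ((n : ℂ) + 1)⁻¹) atTop (𝓝[≠] 0) := by
        refine tendsto_nhdsWithin_iff.2 ⟨?_, Eventually.of_forall fun n => ?_⟩
        · simpa [one_div] using tendsto_one_div_add_atTop_nhds_zero_nat (𝕜 := ℂ)
        · simpa using Nat.cast_add_one_ne_zero n
      have h5 := h3.comp h4
      simpa [Function.comp_def] using h5
    exact aestronglyMeasurable_of_tendsto_ae atTop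
      (fun n => ((hH.meas _).sub (hH.meas _)).const_mul _) (ae_of_all _ hlim)
  dom R hR := by
    obtain ⟨b, hb, h⟩ := hH.dom (R + 1) (by linarith)
    refine ⟨b, hb, fun p y w hw => ?_⟩
    have := (hH.entire p).norm_iterate_complexPartial_le i 1 (z := realEmbed d y + w) one_pos
      (M := b p) (fun v hv => by
        rw [add_assoc]
        refine h p y _ fun k => ?_
        refine (norm_add_le _ _).trans (add_le_add (hw k) ?_)
        rcases eq_or_ne k i with rfl | hk
        · simp [hv]
        · simp [hk])
    simpa using this

/-- The complexified coordinate form `v ↦ v i`. -/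
noncomputable def coordForm (i : Fin d) : RSpace d →L[ℝ] ℂ :=
  Complex.ofRealCLM.comp (EuclideanSpace.proj i)

lemma norm_coordForm_le (i : Fin d) : ‖coordForm i‖ ≤ 1 :=
  ContinuousLinearMap.opNorm_le_bound _ zero_le_one fun v => by
    simpa [coordForm] using PiLp.norm_apply_le v i

lemma IsEntire.hasFDerivAt_sum {F : (Fin d → ℂ) → ℂ} (hF : IsEntire F) (y : RSpace d) :
    HasFDerivAt (F ∘ realEmbed d)
      (∑ i, GelfandShilov.complexPartial i F (realEmbed d y) • coordForm i) y := by
  refine (hF.hasFDerivAt_comp_realEmbed y).congr_fderiv ?_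
  ext v
  have := LinearMap.pi_apply_eq_sum_univ (fderiv ℂ F (realEmbed d y)).toLinearMap (realEmbed d v)
  have hs : ∀ i : Fin d, (fun j => if i = j then (1 : ℂ) else 0) = Pi.single i 1 := fun i => by
    funext j
    simp [Pi.single_apply, eq_comm]
  simp only [ContinuousLinearMap.coe_coe, hs] at this
  simp [GelfandShilov.complexPartial, coordForm, this, mul_comm]

lemma IsDominatedFamily.hasFDerivAt_integral {H : P → (Fin d → ℂ) → ℂ}
    (hH : IsDominatedFamily μ H) (y : RSpace d) :
    HasFDerivAt (fun y => ∫ p, H p (realEmbed d y) ∂μ)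
      (∑ i, (∫ p, GelfandShilov.complexPartial i (H p) (realEmbed d y) ∂μ) • coordForm i) y := by
  choose b hb hbb using fun i => (hH.complexPartial i).exists_bound
  have h := hasFDerivAt_integral_of_dominated_of_fderiv_le (𝕜 := ℝ) (μ := μ) (s := Set.univ)
    (x₀ := y) (F := fun y p => H p (realEmbed d y))
    (F' := fun y p => ∑ i, GelfandShilov.complexPartial i (H p) (realEmbed d y) • coordForm i)
    (bound := fun p => ∑ i, b i p) univ_mem
    (Eventually.of_forall fun y => hH.meas _) (hH.integrable y)
    (Finset.aestronglyMeasurable_fun_sum _ fun i _ =>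
      ((hH.complexPartial i).meas _).smul_const _)
    (ae_of_all _ fun p y _ => (norm_sum_le _ _).trans (Finset.sum_le_sum fun i _ => by
      rw [norm_smul]
      calc _ ≤ b i p * 1 := mul_le_mul (hbb i p y) (norm_coordForm_le i) (norm_nonneg _)
            ((norm_nonneg _).trans (hbb i p y))
        _ = _ := mul_one _))
    (integrable_finsetSum _ fun i _ => hb i)
    (ae_of_all _ fun p y _ => (hH.entire p).hasFDerivAt_sum y)
  refine h.congr_fderiv ?_
  rw [integral_finsetSum _ fun i _ => ((hH.complexPartial i).integrable y).smul_const _]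
  exact Finset.sum_congr rfl fun i _ => integral_smul_const _ _

lemma IsDominatedFamily.contDiff_integral {H : P → (Fin d → ℂ) → ℂ}
    (hH : IsDominatedFamily μ H) :
    ContDiff ℝ ((⊤ : ℕ∞) : WithTop ℕ∞) (fun y => ∫ p, H p (realEmbed d y) ∂μ) := by
  rw [contDiff_infty]
  intro n
  induction n generalizing H with
  | zero =>
    rw [Nat.cast_zero, contDiff_zero, continuous_iff_continuousAt]
    exact fun y => (hH.hasFDerivAt_integral y).continuousAt
  | succ n ih =>
    rw [Nat.cast_succ, contDiff_succ_iff_fderiv]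
    refine ⟨fun y => (hH.hasFDerivAt_integral y).differentiableAt, fun h => by simp at h, ?_⟩
    have : fderiv ℝ (fun y => ∫ p, H p (realEmbed d y) ∂μ) = fun y =>
        ∑ i, (∫ p, GelfandShilov.complexPartial i (H p) (realEmbed d y) ∂μ) • coordForm i :=
      funext fun y => (hH.hasFDerivAt_integral y).fderiv
    rw [this]
    exact ContDiff.sum fun i _ => (ih (hH.complexPartial i)).smul contDiff_const

lemma IsDominatedFamily.partialDeriv_integral {H : P → (Fin d → ℂ) → ℂ}
    (hH : IsDominatedFamily μ H) (i : Fin d) :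
    partialDeriv i (fun y => ∫ p, H p (realEmbed d y) ∂μ) =
      fun y => ∫ p, GelfandShilov.complexPartial i (H p) (realEmbed d y) ∂μ := by
  funext y
  rw [partialDeriv, (hH.hasFDerivAt_integral y).fderiv]
  simp [coordForm, apply_ite]

lemma IsDominatedFamily.iterate {H : P → (Fin d → ℂ) → ℂ} (hH : IsDominatedFamily μ H)
    (i : Fin d) (n : ℕ) :
    IsDominatedFamily μ (fun p => (GelfandShilov.complexPartial i)^[n] (H p)) ∧
    (partialDeriv i)^[n] (fun y => ∫ p, H p (realEmbed d y) ∂μ) =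
      fun y => ∫ p, (GelfandShilov.complexPartial i)^[n] (H p) (realEmbed d y) ∂μ := by
  induction n generalizing H with
  | zero => exact ⟨hH, rfl⟩
  | succ n ih =>
    have := ih (hH.complexPartial i)
    simp only [Function.iterate_succ_apply, hH.partialDeriv_integral]
    exact this

lemma IsDominatedFamily.multiDeriv_integral {H : P → (Fin d → ℂ) → ℂ}
    (hH : IsDominatedFamily μ H) (β : Fin d → ℕ) :
    multiDeriv β (fun y => ∫ p, H p (realEmbed d y) ∂μ) =
      fun y => ∫ p, multiDeriv β (H p ∘ realEmbed d) y ∂μ := by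
  unfold multiDeriv
  suffices h : ∀ l : List (Fin d),
      IsDominatedFamily μ
        (fun p => l.foldr (fun i g => (GelfandShilov.complexPartial i)^[β i] g) (H p)) ∧
      l.foldr (fun i g => (partialDeriv i)^[β i] g) (fun y => ∫ p, H p (realEmbed d y) ∂μ) =
        fun y => ∫ p,
          l.foldr (fun i g => (GelfandShilov.complexPartial i)^[β i] g) (H p) (realEmbed d y) ∂μ by
    rw [(h _).2]
    funext y
    congr 1
    funext p
    rw [(foldr_partialDeriv_comp_realEmbed (hH.entire p) β _).2]
    rfl
  intro l
  induction l with
  | nil => exact ⟨hH, rfl⟩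
  | cons i l ih =>
    simp only [List.foldr_cons]
    rw [ih.2]
    exact ih.1.iterate i (β i)

end ParametricIntegral

/-! ### Gelfand-Shilov steps inside bounded functions, and superpositions of packets. -/

/-- The index set of the seminorms defining `gsNorm`. -/
abbrev GSIndex (d : ℕ) : Type := (Fin d → ℕ) × (Fin d → ℕ) × RSpace d

/-- The smooth functions with `gsNorm θ C f < ∞`. -/
def GSStep (d : ℕ) (θ : ℝ) {C : ℝ} (hC : 0 < C) : Submodule ℂ (RSpace d → ℂ) where
  carrier := {f | ContDiff ℝ ((⊤ : ℕ∞) : WithTop ℕ∞) f ∧ gsNorm θ C f < ∞}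
  add_mem' hf hg := ⟨hf.1.add hg.1,
    (gsNorm_add_le hC hf.1 hg.1).trans_lt (ENNReal.add_lt_top.2 ⟨hf.2, hg.2⟩)⟩
  zero_mem' := ⟨contDiff_const, by
    have h := gsNorm_smul_le (θ := θ) hC 0
      (contDiff_const : ContDiff ℝ ((⊤ : ℕ∞) : WithTop ℕ∞) fun _ : RSpace d => (0 : ℂ))
    rw [norm_zero, ENNReal.ofReal_zero, zero_mul] at h
    refine lt_of_le_of_lt (le_trans (le_of_eq ?_) h) ENNReal.zero_lt_top
    simp [Pi.zero_def]⟩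
  smul_mem' c _ hf := ⟨contDiff_const.smul hf.1,
    (gsNorm_smul_le hC c hf.1).trans_lt (ENNReal.mul_lt_top ENNReal.ofReal_lt_top hf.2)⟩

/-- The weighted derivative `x^α ∂^β f(x) / gsWeight θ C α β`. -/
noncomputable def gsEntry (θ C : ℝ) (f : RSpace d → ℂ) (a : GSIndex d) : ℂ :=
  ((monomial a.1 a.2.2 / gsWeight θ C a.1 a.2.1 : ℝ) : ℂ) * multiDeriv a.2.1 f a.2.2

lemma norm_gsEntry {θ C : ℝ} (hC : 0 < C) (f : RSpace d → ℂ) (a : GSIndex d) :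
    ‖gsEntry θ C f a‖ =
      |monomial a.1 a.2.2| * ‖multiDeriv a.2.1 f a.2.2‖ / gsWeight θ C a.1 a.2.1 := by
  rw [gsEntry, norm_mul, Complex.norm_real, Real.norm_eq_abs, abs_div,
    abs_of_pos (gsWeight_pos hC _ _)]
  ring

lemma norm_gsEntry_le {θ C : ℝ} (hC : 0 < C) {f : RSpace d → ℂ} (hf : gsNorm θ C f < ∞)
    (a : GSIndex d) : ‖gsEntry θ C f a‖ ≤ (gsNorm θ C f).toReal := by
  rw [norm_gsEntry hC]
  exact (ENNReal.ofReal_le_iff_le_toReal hf.ne).1 (le_gsNorm θ C f a.1 a.2.1 a.2.2)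

lemma gsNorm_le_of_forall_norm_gsEntry_le {θ C B : ℝ} (hC : 0 < C) {f : RSpace d → ℂ}
    (h : ∀ a, ‖gsEntry θ C f a‖ ≤ B) : gsNorm θ C f ≤ ENNReal.ofReal B :=
  iSup_le fun α => iSup_le fun β => iSup_le fun x => ENNReal.ofReal_le_ofReal
    ((norm_gsEntry hC f (α, β, x)).symm.le.trans (h _))

lemma multiDeriv_zero (f : RSpace d → ℂ) : multiDeriv 0 f = f := by
  unfold multiDeriv
  induction List.finRange d with
  | nil => rfl
  | cons i l ih => simp

lemma gsEntry_zero_zero (θ C : ℝ) (f : RSpace d → ℂ) (x : RSpace d) :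
    gsEntry θ C f (0, 0, x) = f x := by
  simp [gsEntry, monomial, gsWeight, multiLength, multiFactorial, multiDeriv_zero]

/-- The isometric embedding of `GSStep` into the bounded functions on the index set. -/
noncomputable def gsEmbed (θ : ℝ) {C : ℝ} (hC : 0 < C) :
    GSStep d θ hC →ₗ[ℂ] lp (fun _ : GSIndex d => ℂ) ∞ where
  toFun f := ⟨gsEntry θ C f, memℓp_infty ⟨(gsNorm θ C (f : RSpace d → ℂ)).toReal, by
    rintro _ ⟨a, rfl⟩
    exact norm_gsEntry_le hC f.2.2 a⟩⟩
  map_add' f g := by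
    ext a
    change gsEntry θ C ((f : RSpace d → ℂ) + (g : RSpace d → ℂ)) a = gsEntry θ C f a + gsEntry θ C g a
    simp only [gsEntry, (multiDeriv_props a.2.1 f.2.1 g.2.1 1).1, Pi.add_apply, mul_add]
  map_smul' c f := by
    ext a
    change gsEntry θ C (c • (f : RSpace d → ℂ)) a = c * gsEntry θ C f a
    simp only [gsEntry, (multiDeriv_props a.2.1 f.2.1 f.2.1 c).2, Pi.smul_apply, smul_eq_mul,
      mul_left_comm]

@[simp] lemma gsEmbed_apply (θ : ℝ) {C : ℝ} (hC : 0 < C) (f : GSStep d θ hC) (a : GSIndex d) :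
    gsEmbed θ hC f a = gsEntry θ C f a := rfl

lemma gsEmbed_injective (θ : ℝ) {C : ℝ} (hC : 0 < C) :
    Function.Injective (gsEmbed (d := d) θ hC) := by
  intro f g h
  ext x
  have := congrArg (fun v : lp (fun _ : GSIndex d => ℂ) ∞ => v (0, 0, x)) h
  simpa [gsEntry_zero_zero] using this

lemma gsNorm_le_norm_gsEmbed (θ : ℝ) {C : ℝ} (hC : 0 < C) (f : GSStep d θ hC) :
    gsNorm θ C (f : RSpace d → ℂ) ≤ ENNReal.ofReal ‖gsEmbed θ hC f‖ :=
  gsNorm_le_of_forall_norm_gsEntry_le hC fun a =>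
    lp.norm_apply_le_norm (by simp) (gsEmbed θ hC f) a

lemma norm_gsEmbed_le (θ : ℝ) {C : ℝ} (hC : 0 < C) (f : GSStep d θ hC) :
    ‖gsEmbed θ hC f‖ ≤ (gsNorm θ C (f : RSpace d → ℂ)).toReal :=
  lp.norm_le_of_forall_le ENNReal.toReal_nonneg fun a => norm_gsEntry_le hC f.2.2 a

lemma GSStep.mem_GS {θ C : ℝ} {hC : 0 < C} (f : GSStep d θ hC) : (f : RSpace d → ℂ) ∈ GS d θ :=
  ⟨f.2.1, C, hC, f.2.2⟩

/-- An ultradistribution extends from `GSStep` to a continuous functional on bounded functions. -/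
lemma GSDual.exists_extension {θ : ℝ} (u : GSDual d θ) {C : ℝ} (hC : 0 < C) :
    ∃ L : lp (fun _ : GSIndex d => ℂ) ∞ →L[ℂ] ℂ, ∀ f : GSStep d θ hC,
      L (gsEmbed θ hC f) = u.toLinearMap ⟨f, GSStep.mem_GS f⟩ := by
  obtain ⟨K, hK, hu⟩ := u.bound' C hC
  let e := LinearEquiv.ofInjective (gsEmbed (d := d) θ hC) (gsEmbed_injective θ hC)
  let incl : GSStep d θ hC →ₗ[ℂ] GS d θ :=
    Submodule.inclusion fun f hf => GSStep.mem_GS (⟨f, hf⟩ : GSStep d θ hC)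
  let φ : LinearMap.range (gsEmbed (d := d) θ hC) →ₗ[ℂ] ℂ := (u.toLinearMap ∘ₗ incl) ∘ₗ e.symm
  have hφ : ∀ v, ‖φ v‖ ≤ K * ‖v‖ := by
    intro v
    obtain ⟨f, rfl⟩ := e.surjective v
    have h1 : φ (e f) = u.toLinearMap (incl f) := by simp [φ]
    have h2 : ‖e f‖ = ‖gsEmbed θ hC f‖ := rfl
    rw [h1, h2]
    have h3 : ‖u.toLinearMap (incl f)‖ₑ ≤ ENNReal.ofReal (K * ‖gsEmbed θ hC f‖) := by
      rw [ENNReal.ofReal_mul K.coe_nonneg, ENNReal.ofReal_coe_nnreal]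
      exact (hu (incl f)).trans (mul_le_mul_right (gsNorm_le_norm_gsEmbed θ hC f) _)
    rw [← ofReal_norm] at h3
    exact (ENNReal.ofReal_le_ofReal_iff (by positivity)).1 h3
  -- Hahn-Banach: the integral of a family in the range is formed in the whole Banach space of
  -- bounded functions, so the functional must be defined there.
  obtain ⟨L, hL, -⟩ := exists_extension_norm_eq _ (φ.mkContinuous K hφ)
  refine ⟨L, fun f => ?_⟩
  have := hL (e f)
  have h1 : φ (e f) = u.toLinearMap (incl f) := by simp [φ]
  rw [LinearMap.mkContinuous_apply, h1] at this
  exact this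

/-- The wave packet as an element of `S_θ`. -/
noncomputable def packetGS {θ : ℝ} (hθ : 1 / 2 ≤ θ) (hθ' : θ < 1) {M : Matrix (Fin d) (Fin d) ℂ}
    (hM : M.IsSymm) (hP : (M.map Complex.im).PosDef) (p : RSpace d × RSpace d) : GS d θ :=
  ⟨packet M p, memGS_packet hθ hθ' hM hP p⟩

lemma GSDual.continuous_packetGS {θ : ℝ} (hθ : 1 / 2 ≤ θ) (hθ' : θ < 1)
    {M : Matrix (Fin d) (Fin d) ℂ} (hM : M.IsSymm) (hP : (M.map Complex.im).PosDef)
    (u : GSDual d θ) : Continuous fun p => u.toLinearMap (packetGS hθ hθ' hM hP p) := by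
  obtain ⟨C, hC, K, hK, -, hcont⟩ := exists_gsNorm_packet_le hθ hθ' one_pos hM hP
  obtain ⟨B, hB, hu⟩ := u.bound' C hC
  rw [continuous_iff_continuousAt]
  intro p₀
  rw [ContinuousAt, tendsto_iff_edist_tendsto_0]
  have hlim : Tendsto (fun p => (B : ℝ≥0∞) * gsNorm θ C (packet M p - packet M p₀)) (𝓝 p₀)
      (𝓝 0) := by
    have := ENNReal.Tendsto.const_mul (a := (B : ℝ≥0∞)) (hcont p₀) (Or.inr ENNReal.coe_ne_top)
    simpa using this
  refine tendsto_of_tendsto_of_tendsto_of_le_of_le tendsto_const_nhds hlim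
    (fun _ => zero_le) fun p => ?_
  rw [edist_eq_enorm_sub, ← map_sub]
  exact hu _

lemma integrable_exp_neg_mul_norm_rpow_prod {a q : ℝ} (ha : 0 < a) (hq : 1 ≤ q) :
    Integrable (fun p : RSpace d × RSpace d => Real.exp (-a * ‖p‖ ^ q)) :=
  integrable_exp_neg_mul_norm_rpow ((volume : Measure (RSpace d)).prod volume) ha hq

/-- On a strip of width `R` the packets grow like the exponential of a linear function of `‖p‖`. As
`1/θ > 1`, half of the decay of the coefficients absorbs this and the other half is integrable. -/
lemma isDominatedFamily_packetExt {θ ε K : ℝ} (hθ : 1 / 2 ≤ θ) (hθ' : θ < 1)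
    {M : Matrix (Fin d) (Fin d) ℂ} (hP : (M.map Complex.im).PosDef) (hε : 0 < ε)
    {h : RSpace d × RSpace d → ℂ} (hmeas : AEStronglyMeasurable h volume)
    (hdecay : ∀ p, ‖h p‖ ≤ K * Real.exp (-ε * ‖p‖ ^ (1 / θ))) :
    IsDominatedFamily volume (fun p z => h p * packetExt M p z) where
  entire p := contDiff_const.mul (isEntire_packetExt M p)
  meas z := by
    refine hmeas.mul (Continuous.aestronglyMeasurable ?_)
    unfold packetExt
    simp only [dotProduct, Matrix.mulVec]
    fun_prop
  dom R hR := by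
    have hθ0 : 0 < θ := by linarith
    have hq : 1 < 1 / θ := by rw [lt_div_iff₀ hθ0]; linarith
    obtain ⟨c, hc, D, hD, hb⟩ := exists_norm_packetExt_le hP
    obtain ⟨B, hB⟩ := exists_mul_le_mul_rpow_add (A := d * (2 * Real.pi * R)) hq (half_pos hε)
      (by positivity)
    refine ⟨fun p => K * Real.exp (B + d * (D * R ^ 2)) * Real.exp (-(ε / 2) * ‖p‖ ^ (1 / θ)),
      (integrable_exp_neg_mul_norm_rpow_prod (half_pos hε) hq.le).const_mul _, fun p y w hw => ?_⟩
    have hK : 0 ≤ K * Real.exp (-ε * ‖p‖ ^ (1 / θ)) := (norm_nonneg _).trans (hdecay p)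
    rw [norm_mul]
    have h1 : ‖packetExt M p (realEmbed d y + w)‖ ≤
        Real.exp (ε / 2 * ‖p‖ ^ (1 / θ) + B + d * (D * R ^ 2)) := by
      refine (hb p y w).trans (Real.exp_le_exp.2 ?_)
      have h2 : ∑ j, (2 * Real.pi * |p.2 j| * ‖w j‖ + D * ‖w j‖ ^ 2) ≤
          d * (2 * Real.pi * ‖p‖ * R + D * R ^ 2) := by
        have : ∀ j ∈ Finset.univ, 2 * Real.pi * |p.2 j| * ‖w j‖ + D * ‖w j‖ ^ 2 ≤
            2 * Real.pi * ‖p‖ * R + D * R ^ 2 := fun j _ => by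
          gcongr
          · exact (PiLp.norm_apply_le p.2 j).trans (norm_snd_le p)
          · exact hw j
          · exact hw j
        refine (Finset.sum_le_card_nsmul _ _ _ this).trans (le_of_eq ?_)
        simp [mul_add]
      have h3 := hB ‖p‖ (norm_nonneg p)
      have h4 : 0 ≤ c * ‖y - p.1‖ ^ 2 := by positivity
      linarith
    calc ‖h p‖ * ‖packetExt M p (realEmbed d y + w)‖
        ≤ (K * Real.exp (-ε * ‖p‖ ^ (1 / θ))) *
          Real.exp (ε / 2 * ‖p‖ ^ (1 / θ) + B + d * (D * R ^ 2)) :=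
          mul_le_mul (hdecay p) h1 (norm_nonneg _) hK
      _ = K * Real.exp (B + d * (D * R ^ 2) + -(ε / 2) * ‖p‖ ^ (1 / θ)) := by
          rw [mul_assoc, ← Real.exp_add]; congr 2; ring
      _ = _ := by rw [Real.exp_add]; ring

/-- Superpositions of wave packets with exponentially decaying coefficients lie in `S_θ`, and
ultradistributions may be applied under the integral sign. -/
theorem exists_superposition {θ ε K : ℝ} (hθ : 1 / 2 ≤ θ) (hθ' : θ < 1)
    {M : Matrix (Fin d) (Fin d) ℂ} (hM : M.IsSymm) (hP : (M.map Complex.im).PosDef) (hε : 0 < ε)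
    {h : RSpace d × RSpace d → ℂ} (hmeas : AEStronglyMeasurable h volume)
    (hdecay : ∀ p, ‖h p‖ ≤ K * Real.exp (-ε * ‖p‖ ^ (1 / θ))) :
    ∃ F : GS d θ, (∀ y, (F : RSpace d → ℂ) y = ∫ p, h p * packet M p y) ∧
      ∀ u : GSDual d θ, u.toLinearMap F = ∫ p, h p * u.toLinearMap (packetGS hθ hθ' hM hP p) := by
  have hθ0 : 0 < θ := by linarith
  have hq : 1 ≤ 1 / θ := by rw [le_div_iff₀ hθ0]; linarith
  have hfam := isDominatedFamily_packetExt hθ hθ' hP hε hmeas hdecay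
  -- Growth rate `ε/2` for the packets, against decay rate `ε` of the coefficients.
  obtain ⟨C, hC, B, hB, hnorm, hcont⟩ := exists_gsNorm_packet_le hθ hθ' (half_pos hε) hM hP
  set k : RSpace d × RSpace d → GSStep d θ hC := fun p =>
    ⟨packet M p, contDiff_packet M p, (hnorm p).trans_lt ENNReal.ofReal_lt_top⟩ with hk
  set Ψ : RSpace d × RSpace d → lp (fun _ : GSIndex d => ℂ) ∞ := fun p => gsEmbed θ hC (k p) with hΨ
  have hΨcont : Continuous Ψ := by
    rw [continuous_iff_continuousAt]
    intro p₀
    rw [ContinuousAt, tendsto_iff_edist_tendsto_0]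
    refine tendsto_of_tendsto_of_tendsto_of_le_of_le tendsto_const_nhds (hcont p₀)
      (fun _ => zero_le) fun p => ?_
    rw [edist_eq_enorm_sub, hΨ, ← map_sub, ← ofReal_norm]
    exact ENNReal.ofReal_le_of_le_toReal (norm_gsEmbed_le θ hC _)
  have hΨnorm : ∀ p, ‖Ψ p‖ ≤ B * Real.exp (ε / 2 * ‖p‖ ^ (1 / θ)) := fun p =>
    (norm_gsEmbed_le θ hC _).trans (ENNReal.toReal_le_of_le_ofReal (by positivity) (hnorm p))
  have hint : Integrable (fun p => h p • Ψ p) := by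
    refine ((integrable_exp_neg_mul_norm_rpow_prod (half_pos hε) hq).const_mul (K * B)).mono'
      (hmeas.smul hΨcont.aestronglyMeasurable) (ae_of_all _ fun p => ?_)
    have hK : 0 ≤ K * Real.exp (-ε * ‖p‖ ^ (1 / θ)) := (norm_nonneg _).trans (hdecay p)
    rw [norm_smul]
    calc ‖h p‖ * ‖Ψ p‖ ≤ (K * Real.exp (-ε * ‖p‖ ^ (1 / θ))) *
          (B * Real.exp (ε / 2 * ‖p‖ ^ (1 / θ))) :=
          mul_le_mul (hdecay p) (hΨnorm p) (norm_nonneg _) hK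
      _ = K * B * (Real.exp (-ε * ‖p‖ ^ (1 / θ)) * Real.exp (ε / 2 * ‖p‖ ^ (1 / θ))) := by ring
      _ = _ := by rw [← Real.exp_add]; congr 2; ring
  set V := ∫ p, h p • Ψ p with hV
  set F : RSpace d → ℂ := fun y => ∫ p, h p * packetExt M p (realEmbed d y) with hF
  -- Evaluation at an index commutes with the Bochner integral, and differentiation under the
  -- integral sign identifies the entries of the vector `V` with those of the pointwise integral
  -- `F`.
  have hVF : ∀ a, V a = gsEntry θ C F a := by
    intro a
    have h1 := (lp.evalCLM ℂ (fun _ : GSIndex d => ℂ) ∞ a).integral_comp_comm hint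
    have h2 : ∀ p, (lp.evalCLM ℂ (fun _ : GSIndex d => ℂ) ∞ a) (h p • Ψ p) =
        ((monomial a.1 a.2.2 / gsWeight θ C a.1 a.2.1 : ℝ) : ℂ) *
          multiDeriv a.2.1 ((fun z => h p * packetExt M p z) ∘ realEmbed d) a.2.2 := fun p => by
      have h3 := (multiDeriv_props a.2.1 (contDiff_packet M p) (contDiff_packet M p) (h p)).2
      have h4 : (fun z => h p * packetExt M p z) ∘ realEmbed d = h p • packet M p := rfl
      rw [h4, h3]
      change h p • gsEntry θ C (packet M p) a = _
      simp only [gsEntry, Pi.smul_apply, smul_eq_mul]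
      ring
    simp only [h2] at h1
    rw [integral_const_mul] at h1
    rw [gsEntry, hF, hfam.multiDeriv_integral]
    exact h1.symm
  have hFmem : ContDiff ℝ ((⊤ : ℕ∞) : WithTop ℕ∞) F ∧ gsNorm θ C F < ∞ :=
    ⟨hfam.contDiff_integral, (gsNorm_le_of_forall_norm_gsEntry_le hC fun a => by
      rw [← hVF]; exact lp.norm_apply_le_norm (by simp) V a).trans_lt ENNReal.ofReal_lt_top⟩
  refine ⟨⟨F, hFmem.1, C, hC, hFmem.2⟩, fun y => rfl, fun u => ?_⟩
  obtain ⟨L, hL⟩ := u.exists_extension hC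
  have h5 : gsEmbed θ hC ⟨F, hFmem⟩ = V := by
    ext a
    rw [hVF]; rfl
  have h6 := hL ⟨F, hFmem⟩
  rw [h5, hV, ← L.integral_comp_comm hint] at h6
  rw [← h6]
  congr 1
  funext p
  rw [map_smul, smul_eq_mul, hΨ, hL]
  rfl

/-! ### Decay of functions in `S_θ` and the ultradistributions they define. -/

section FunctionBounds

lemma foldr_iterate_partialDeriv_single (j : Fin d) (n : ℕ) (f : RSpace d → ℂ) (l : List (Fin d))
    (hl : l.Nodup) :
    l.foldr (fun i g => (partialDeriv i)^[(Pi.single j n : Fin d → ℕ) i] g) f =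
      if j ∈ l then (partialDeriv j)^[n] f else f := by
  induction l with
  | nil => simp
  | cons i l ih =>
    rw [List.nodup_cons] at hl
    rw [List.foldr_cons, ih hl.2]
    rcases eq_or_ne j i with rfl | h
    · simp [hl.1]
    · simp [h, h.symm]

lemma multiDeriv_single (j : Fin d) (n : ℕ) (f : RSpace d → ℂ) :
    multiDeriv (Pi.single j n) f = (partialDeriv j)^[n] f := by
  rw [multiDeriv, foldr_iterate_partialDeriv_single _ _ _ _ (List.nodup_finRange d)]
  simp

lemma monomial_single (j : Fin d) (n : ℕ) (x : RSpace d) :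
    monomial (Pi.single j n) x = x j ^ n := by
  rw [monomial, Finset.prod_eq_single j (fun k _ hk => by simp [hk]) (by simp)]
  simp

lemma multiFactorial_single (j : Fin d) (n : ℕ) :
    multiFactorial (Pi.single j n) = n.factorial := by
  rw [multiFactorial, Finset.prod_eq_single j (fun k _ hk => by simp [hk]) (by simp)]
  simp

lemma multiLength_single (j : Fin d) (n : ℕ) : multiLength (Pi.single j n) = n := by
  simp [multiLength]

/-- Only pure powers and pure derivatives along one axis are needed to obtain decay in position and
in frequency. -/
lemma MemGS.exists_bounds {θ : ℝ} {f : RSpace d → ℂ} (hf : MemGS θ f) :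
    ∃ C : ℝ, 1 ≤ C ∧ ∃ B : ℝ, 0 ≤ B ∧ (∀ y, ‖f y‖ ≤ B) ∧
      (∀ (j : Fin d) (n : ℕ) (y : RSpace d),
        |y j| ^ n * ‖f y‖ ≤ B * C ^ n * (n.factorial : ℝ) ^ θ) ∧
      ∀ (j : Fin d) (n : ℕ) (y : RSpace d),
        ‖(partialDeriv j)^[n] f y‖ ≤ B * C ^ n * (n.factorial : ℝ) ^ θ := by
  obtain ⟨-, C₀, hC₀, hfin₀⟩ := hf
  set C := max C₀ 1 with hCdef
  have hC : 0 < C := by positivity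
  have hfin := (gsNorm_anti (θ := θ) hC₀ (le_max_left C₀ 1) f).trans_lt hfin₀
  have key : ∀ α β y, |monomial α y| * ‖multiDeriv β f y‖ ≤
      (gsNorm θ C f).toReal * gsWeight θ C α β := fun α β y => by
    have := norm_gsEntry_le hC hfin (α, β, y)
    rwa [norm_gsEntry hC, div_le_iff₀ (gsWeight_pos hC α β)] at this
  have hz : multiLength (0 : Fin d → ℕ) = 0 ∧ multiFactorial (0 : Fin d → ℕ) = 1 := by
    simp [multiLength, multiFactorial]
  refine ⟨C, le_max_right _ _, (gsNorm θ C f).toReal, ENNReal.toReal_nonneg, fun y => ?_,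
    fun j n y => ?_, fun j n y => ?_⟩
  · have := key 0 0 y
    simpa [monomial, gsWeight, hz, multiDeriv_zero] using this
  · have := key (Pi.single j n) 0 y
    simpa [monomial_single, gsWeight, hz, multiDeriv_zero, multiLength_single,
      multiFactorial_single, abs_pow, mul_assoc] using this
  · have := key 0 (Pi.single j n) y
    simpa [monomial, gsWeight, hz, multiDeriv_single, multiLength_single,
      multiFactorial_single, mul_assoc] using this

/-- Some coordinate has size at least `‖v‖/(d+1)`, since `d < (d+1)²`. The separate bound `A ≤ K`
serves `v = 0`, in particular `d = 0`. -/
lemma le_exp_neg_norm_rpow_of_forall_coord {A K ε q : ℝ} (hε : 0 < ε) (hq : 0 < q) (hK : 0 ≤ K)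
    {v : RSpace d} (hA : A ≤ K) (h : ∀ j, A ≤ K * Real.exp (-ε * |v j| ^ q)) :
    A ≤ K * Real.exp (-(ε / (d + 1) ^ q) * ‖v‖ ^ q) := by
  rcases eq_or_ne v 0 with rfl | hv
  · simpa [Real.zero_rpow hq.ne'] using hA
  have hv0 : 0 < ‖v‖ := norm_pos_iff.2 hv
  obtain ⟨j, hj⟩ : ∃ j, ‖v‖ / (d + 1) ≤ |v j| := by
    by_contra! hcon
    have h1 : ‖v‖ ^ 2 ≤ d * (‖v‖ / (d + 1)) ^ 2 := by
      rw [EuclideanSpace.norm_sq_eq]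
      have : ∀ j ∈ Finset.univ, ‖v j‖ ^ 2 ≤ (‖v‖ / (d + 1)) ^ 2 := fun j _ => by
        rw [Real.norm_eq_abs]
        have := (hcon j).le
        gcongr
      refine (Finset.sum_le_card_nsmul _ _ _ this).trans (le_of_eq ?_)
      simp
    rw [div_pow, mul_div_assoc', le_div_iff₀ (by positivity)] at h1
    have hd : (0 : ℝ) ≤ d := Nat.cast_nonneg d
    nlinarith [sq_pos_of_pos hv0, mul_nonneg hd (sq_nonneg ‖v‖), mul_nonneg hd hd,
      mul_nonneg (mul_nonneg hd hd) (sq_nonneg ‖v‖)]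
  refine (h j).trans ?_
  gcongr K * Real.exp ?_
  have h2 : ‖v‖ ^ q / (d + 1) ^ q ≤ |v j| ^ q := by
    rw [← Real.div_rpow (by positivity) (by positivity)]
    gcongr
  have h3 : ε * (‖v‖ ^ q / (d + 1) ^ q) ≤ ε * |v j| ^ q := by gcongr
  have h4 : ε / (d + 1) ^ q * ‖v‖ ^ q = ε * (‖v‖ ^ q / (d + 1) ^ q) := by ring
  linarith

lemma MemGS.exists_decay {θ : ℝ} (hθ : 0 < θ) {f : RSpace d → ℂ} (hf : MemGS θ f) :
    ∃ ε : ℝ, 0 < ε ∧ ∃ K : ℝ, 0 ≤ K ∧ ∀ y, ‖f y‖ ≤ K * Real.exp (-ε * ‖y‖ ^ (1 / θ)) := by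
  obtain ⟨C, hC, B, hB, h0, h1, -⟩ := hf.exists_bounds
  have hC0 : 0 < C := by linarith
  refine ⟨θ / (2 * C ^ (1 / θ)) / (d + 1) ^ (1 / θ), by positivity, 2 ^ θ * B, by positivity,
    fun y => ?_⟩
  refine le_exp_neg_norm_rpow_of_forall_coord (by positivity) (by positivity) (by positivity)
    ((h0 y).trans (le_mul_of_one_le_left hB (Real.one_le_rpow one_le_two hθ.le))) fun j => ?_
  exact le_exp_neg_of_forall_pow_mul_le hθ hC0 (abs_nonneg _) (norm_nonneg _) hB fun n => h1 j n y

lemma MemGS.integrable {θ : ℝ} (hθ : 0 < θ) (hθ' : θ < 1) {f : RSpace d → ℂ} (hf : MemGS θ f) :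
    Integrable f := by
  obtain ⟨ε, hε, K, hK, h⟩ := hf.exists_decay hθ
  exact ((integrable_exp_neg_mul_norm_rpow volume hε
    (by rw [le_div_iff₀ hθ]; linarith)).const_mul K).mono'
    hf.1.continuous.aestronglyMeasurable (ae_of_all _ h)

lemma enorm_le_gsNorm (θ C : ℝ) (f : RSpace d → ℂ) (y : RSpace d) : ‖f y‖ₑ ≤ gsNorm θ C f := by
  have h := le_gsNorm θ C f 0 0 y
  rw [← ofReal_norm]
  simpa [monomial, gsWeight, multiLength, multiFactorial, multiDeriv_zero] using h

lemma MemGS.integrable_mul {θ : ℝ} (hθ : 0 < θ) (hθ' : θ < 1) {f g : RSpace d → ℂ}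
    (hf : MemGS θ f) (hg : MemGS θ g) : Integrable fun y => f y * g y := by
  obtain ⟨C, hC, B, hB, h0, -⟩ := hg.exists_bounds
  exact (hf.integrable hθ hθ').mul_bdd (c := B) hg.1.continuous.aestronglyMeasurable (ae_of_all _ h0)

/-- The ultradistribution `g ↦ ∫ f g` for `f ∈ S_θ`. -/
noncomputable def GSDual.ofGS {θ : ℝ} (hθ : 0 < θ) (hθ' : θ < 1) (f : GS d θ) : GSDual d θ where
  toFun g := ∫ y, (f : RSpace d → ℂ) y * (g : RSpace d → ℂ) y
  map_add' g h := by
    rw [← integral_add (MemGS.integrable_mul hθ hθ' f.2 g.2) (MemGS.integrable_mul hθ hθ' f.2 h.2)]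
    simp [mul_add]
  map_smul' c g := by
    rw [RingHom.id_apply, smul_eq_mul, ← integral_const_mul]
    simp [mul_left_comm]
  bound' ε hε := by
    have hfin : ∫⁻ y, ‖(f : RSpace d → ℂ) y‖ₑ ≠ ∞ := (MemGS.integrable hθ hθ' f.2).2.ne
    -- The added `1` keeps the constant positive when `f` vanishes.
    refine ⟨(∫⁻ y, ‖(f : RSpace d → ℂ) y‖ₑ).toNNReal + 1, by positivity, fun g => ?_⟩
    refine (enorm_integral_le_lintegral_enorm _).trans ?_
    calc ∫⁻ y, ‖(f : RSpace d → ℂ) y * (g : RSpace d → ℂ) y‖ₑ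
        ≤ ∫⁻ y, ‖(f : RSpace d → ℂ) y‖ₑ * gsNorm θ ε (g : RSpace d → ℂ) :=
          lintegral_mono fun y => by
            rw [enorm_mul]
            exact mul_le_mul_right (enorm_le_gsNorm θ ε _ y) _
      _ = (∫⁻ y, ‖(f : RSpace d → ℂ) y‖ₑ) * gsNorm θ ε (g : RSpace d → ℂ) :=
          lintegral_mul_const _ (f.2.1.continuous.enorm.measurable)
      _ ≤ _ := by
          gcongr
          rw [ENNReal.coe_add, ENNReal.coe_toNNReal hfin]
          exact le_self_add

end FunctionBounds

/-! ### Decay of the short-time Fourier transform on `S_θ`. -/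

section Gaussian

lemma integrable_exp_neg_mul_norm_sub_sq {c : ℝ} (hc : 0 < c) (x : RSpace d) :
    Integrable fun y : RSpace d => Real.exp (-c * ‖y - x‖ ^ 2) := by
  have := integrable_exp_neg_mul_norm_rpow (volume : Measure (RSpace d)) hc one_le_two
  simp only [Real.rpow_two] at this
  exact this.comp_sub_right x

lemma integral_exp_neg_mul_norm_sub_sq (c : ℝ) (x : RSpace d) :
    ∫ y : RSpace d, Real.exp (-c * ‖y - x‖ ^ 2) = ∫ y : RSpace d, Real.exp (-c * ‖y‖ ^ 2) :=
  integral_sub_right_eq_self (fun y : RSpace d => Real.exp (-c * ‖y‖ ^ 2)) x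

lemma norm_integral_le_of_norm_le_gaussian {c B : ℝ} (hc : 0 < c) {x : RSpace d}
    {g : RSpace d → ℂ} (h : ∀ y, ‖g y‖ ≤ B * Real.exp (-c * ‖y - x‖ ^ 2)) :
    ‖∫ y, g y‖ ≤ B * ∫ y : RSpace d, Real.exp (-c * ‖y‖ ^ 2) := by
  rw [← integral_exp_neg_mul_norm_sub_sq c x, ← integral_const_mul]
  exact norm_integral_le_of_norm_le ((integrable_exp_neg_mul_norm_sub_sq hc x).const_mul B)
    (ae_of_all _ h)

end Gaussian

section Transform

/-- The character `y ↦ e^{-2πi⟨y, η⟩}`. -/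
noncomputable def expChar (η y : RSpace d) : ℂ :=
  Complex.exp (((-2 * Real.pi * inner ℝ y η : ℝ) : ℂ) * Complex.I)

lemma norm_expChar (η y : RSpace d) : ‖expChar η y‖ = 1 := Complex.norm_exp_ofReal_mul_I _

lemma contDiff_expChar (η : RSpace d) :
    ContDiff ℝ ((⊤ : ℕ∞) : WithTop ℕ∞) (expChar η) := by
  unfold expChar
  have h : ContDiff ℝ ((⊤ : ℕ∞) : WithTop ℕ∞)
      fun y : RSpace d => ((-2 * Real.pi * inner ℝ y η : ℝ) : ℂ) :=
    Complex.ofRealCLM.contDiff.comp (contDiff_const.mul (contDiff_id.inner ℝ contDiff_const))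
  exact (h.mul contDiff_const).cexp

lemma partialDeriv_expChar (j : Fin d) (η y : RSpace d) :
    fderiv ℝ (expChar η) y (EuclideanSpace.single j 1) =
      -2 * Real.pi * Complex.I * η j * expChar η y := by
  have h1 : HasFDerivAt (fun y : RSpace d => (-2 * Real.pi * inner ℝ y η : ℝ))
      ((-2 * Real.pi) • (innerSL ℝ η)) y := by
    have : (fun y : RSpace d => (-2 * Real.pi * inner ℝ y η : ℝ)) =
        fun y => ((-2 * Real.pi) • (innerSL ℝ η)) y := by
      funext y
      simp [real_inner_comm]
    rw [this]
    exact ContinuousLinearMap.hasFDerivAt _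
  have h2 := ((Complex.ofRealCLM.hasFDerivAt.comp y h1).mul_const Complex.I).cexp
  have h3 : expChar η = fun y => Complex.exp
      ((Complex.ofRealCLM ∘ fun y : RSpace d => (-2 * Real.pi * inner ℝ y η : ℝ)) y * Complex.I) :=
    rfl
  rw [h3, h2.fderiv]
  simp [EuclideanSpace.inner_single_right]
  ring

/-- One integration by parts: a factor `2πη j` is traded for a derivative that falls on either `F`
or `G`. -/
lemma two_pi_mul_norm_integral_le {F G : RSpace d → ℂ}
    (hF : ContDiff ℝ ((⊤ : ℕ∞) : WithTop ℕ∞) F) (hG : ContDiff ℝ ((⊤ : ℕ∞) : WithTop ℕ∞) G)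
    (j : Fin d) (η : RSpace d)
    (h0 : Integrable fun y => F y * G y) (h1 : Integrable fun y => partialDeriv j F y * G y)
    (h2 : Integrable fun y => F y * partialDeriv j G y) :
    2 * Real.pi * |η j| * ‖∫ y, F y * G y * expChar η y‖ ≤
      ‖∫ y, partialDeriv j F y * G y * expChar η y‖ +
        ‖∫ y, F y * partialDeriv j G y * expChar η y‖ := by
  have hE := contDiff_expChar η
  have hbdd : ∀ {g : RSpace d → ℂ}, Integrable g → Integrable fun y => g y * expChar η y :=
    fun hg => hg.mul_bdd (c := 1) hE.continuous.aestronglyMeasurable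
      (ae_of_all _ fun y => (norm_expChar η y).le)
  have hdiff : ∀ {g : RSpace d → ℂ}, ContDiff ℝ ((⊤ : ℕ∞) : WithTop ℕ∞) g → Differentiable ℝ g :=
    fun hg => hg.differentiable (by simp)
  have hprod : ∀ y, fderiv ℝ (fun y => F y * G y) y (EuclideanSpace.single j 1) =
      partialDeriv j F y * G y + F y * partialDeriv j G y := fun y => by
    rw [fderiv_fun_mul (hdiff hF y) (hdiff hG y)]
    simp [partialDeriv]
    ring
  have key := integral_mul_fderiv_eq_neg_fderiv_mul_of_integrable (μ := volume)
    (f := fun y => F y * G y) (g := expChar η) (v := EuclideanSpace.single j 1)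
    (by
      simp only [hprod]
      exact hbdd (h1.add h2))
    (by
      simp only [partialDeriv_expChar]
      refine ((hbdd h0).const_mul (-2 * Real.pi * Complex.I * η j)).congr
        (ae_of_all _ fun y => ?_)
      ring)
    (hbdd h0) (fun y _ => ((hdiff hF).mul (hdiff hG)) y) (fun y _ => hdiff hE y)
  simp only [hprod, partialDeriv_expChar, add_mul] at key
  rw [integral_add (hbdd h1) (hbdd h2)] at key
  have e : ∀ y, F y * G y * (-2 * Real.pi * Complex.I * η j * expChar η y) =
      (-2 * Real.pi * Complex.I * η j) * (F y * G y * expChar η y) := fun y => by ring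
  simp only [e] at key
  rw [integral_const_mul] at key
  have hn := congrArg norm key
  rw [norm_mul, norm_neg] at hn
  have hc : ‖(-2 * Real.pi * Complex.I * η j : ℂ)‖ = 2 * Real.pi * |η j| := by
    simp [abs_of_pos Real.pi_pos]
  rw [hc] at hn
  rw [hn]
  exact norm_add_le _ _

lemma contDiff_iterate_partialDeriv {f : RSpace d → ℂ}
    (hf : ContDiff ℝ ((⊤ : ℕ∞) : WithTop ℕ∞) f) (j : Fin d) (n : ℕ) :
    ContDiff ℝ ((⊤ : ℕ∞) : WithTop ℕ∞) ((partialDeriv j)^[n] f) :=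
  (iterate_partialDeriv_props j n hf hf 1).1

/-- The short-time Fourier transform of `f ∈ S_θ` decays exponentially in phase space. -/
theorem exists_norm_integral_mul_packet_le {θ : ℝ} (hθ : 1 / 2 ≤ θ) (hθ' : θ < 1)
    {M : Matrix (Fin d) (Fin d) ℂ} (hP : (M.map Complex.im).PosDef) {f : RSpace d → ℂ}
    (hf : MemGS θ f) :
    ∃ ε : ℝ, 0 < ε ∧ ∃ K : ℝ, 0 ≤ K ∧ ∀ p : RSpace d × RSpace d,
      ‖∫ y, f y * packet M p y‖ ≤ K * Real.exp (-ε * ‖p‖ ^ (1 / θ)) := by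
  have hθ0 : 0 < θ := by linarith
  have hq : 0 < 1 / θ := by positivity
  have hq' : 1 / θ ≤ 2 := by rw [div_le_iff₀ hθ0]; linarith
  -- decay in the position variable
  have hx : ∃ ε : ℝ, 0 < ε ∧ ∃ K : ℝ, 0 ≤ K ∧ ∀ p : RSpace d × RSpace d,
      ‖∫ y, f y * packet M p y‖ ≤ K * Real.exp (-ε * ‖p.1‖ ^ (1 / θ)) := by
    obtain ⟨ε, hε, K, hK, hdec⟩ := hf.exists_decay hθ0
    obtain ⟨c, hc, hpack⟩ := exists_norm_packet_le hP
    -- Half of the Gaussian is spent on moving the weight from `y` to the centre `p.1`, with the `4`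
    -- of `abs_rpow_le_shift`; the other half is kept for integration.
    set ε₁ := min (ε / 4) (c / 8) with hε₁
    have hε₁0 : 0 < ε₁ := by positivity
    have hε₁1 : 4 * ε₁ ≤ ε := by linarith [min_le_left (ε / 4) (c / 8)]
    have hε₁2 : 4 * ε₁ ≤ c / 2 := by linarith [min_le_right (ε / 4) (c / 8)]
    refine ⟨ε₁, hε₁0, K * Real.exp (c / 2) * ∫ y : RSpace d, Real.exp (-(c / 2) * ‖y‖ ^ 2),
      mul_nonneg (by positivity) (integral_nonneg fun _ => (Real.exp_pos _).le), fun p => ?_⟩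
    have hb : ∀ y, ‖f y * packet M p y‖ ≤
        (K * Real.exp (c / 2) * Real.exp (-ε₁ * ‖p.1‖ ^ (1 / θ))) *
          Real.exp (-(c / 2) * ‖y - p.1‖ ^ 2) := fun y => by
      rw [norm_mul]
      calc ‖f y‖ * ‖packet M p y‖ ≤ (K * Real.exp (-ε * ‖y‖ ^ (1 / θ))) *
            Real.exp (-c * ‖y - p.1‖ ^ 2) :=
            mul_le_mul (hdec y) (hpack p y) (norm_nonneg _) (by positivity)
        _ = K * Real.exp (-ε * ‖y‖ ^ (1 / θ) + -c * ‖y - p.1‖ ^ 2) := by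
            rw [Real.exp_add]; ring
        _ ≤ K * Real.exp (c / 2 + -ε₁ * ‖p.1‖ ^ (1 / θ) + -(c / 2) * ‖y - p.1‖ ^ 2) := by
            refine mul_le_mul_of_nonneg_left (Real.exp_le_exp.2 ?_) hK
            have h1 := abs_rpow_le_shift hq.le hq' ‖p.1‖ ‖y‖
            rw [abs_of_nonneg (norm_nonneg p.1), abs_of_nonneg (norm_nonneg y)] at h1
            have h2 : (‖p.1‖ - ‖y‖) ^ 2 ≤ ‖y - p.1‖ ^ 2 := by
              rw [sq_le_sq, abs_of_nonneg (norm_nonneg (y - p.1)), norm_sub_rev]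
              exact abs_norm_sub_norm_le _ _
            have h3 : ε₁ * ‖p.1‖ ^ (1 / θ) ≤
                ε₁ * (4 * ‖y‖ ^ (1 / θ) + 4 * (‖p.1‖ - ‖y‖) ^ 2 + 4) := by gcongr
            have h4 : 4 * ε₁ * ‖y‖ ^ (1 / θ) ≤ ε * ‖y‖ ^ (1 / θ) := by gcongr
            have h5 : 4 * ε₁ * (‖p.1‖ - ‖y‖) ^ 2 ≤ c / 2 * ‖y - p.1‖ ^ 2 := by gcongr
            linarith
        _ = _ := by rw [Real.exp_add, Real.exp_add]; ring
    refine (norm_integral_le_of_norm_le_gaussian (half_pos hc) hb).trans (le_of_eq ?_)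
    ring
  obtain ⟨ε₁, hε₁, K₁, hK₁, h₁⟩ := hx
  -- decay in the frequency variable
  have hη : ∃ ε : ℝ, 0 < ε ∧ ∃ K : ℝ, 0 ≤ K ∧ ∀ p : RSpace d × RSpace d,
      ‖∫ y, f y * packet M p y‖ ≤ K * Real.exp (-ε * ‖p.2‖ ^ (1 / θ)) := by
    obtain ⟨C₁, hC₁, B₁, hB₁, -, -, hfd⟩ := hf.exists_bounds
    obtain ⟨c, hc, C₂, hC₂, hgd⟩ := exists_norm_iterate_partialDeriv_packet_le (d := d) hθ hθ' hP
    set C := max C₁ C₂ with hC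
    have hC1 : 1 ≤ C := le_max_of_le_left hC₁
    have hC0 : 0 < C := by linarith
    set I₀ := ∫ y : RSpace d, Real.exp (-c * ‖y‖ ^ 2) with hI₀
    have hI₀0 : 0 ≤ I₀ := integral_nonneg fun _ => (Real.exp_pos _).le
    set B := B₁ * C₂ * I₀ with hB
    have hB0 : 0 ≤ B := by positivity
    have hptw : ∀ (x : RSpace d) (j : Fin d) (m l : ℕ) (y : RSpace d),
        ‖(partialDeriv j)^[m] f y * (partialDeriv j)^[l] (packet M (x, 0)) y‖ ≤
          (B₁ * C₂ * C ^ (m + l) * ((m + l).factorial : ℝ) ^ θ) *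
            Real.exp (-c * ‖y - x‖ ^ 2) := fun x j m l y => by
      rw [norm_mul]
      have hfac : (m.factorial : ℝ) ^ θ * (l.factorial : ℝ) ^ θ ≤ ((m + l).factorial : ℝ) ^ θ := by
        rw [← Real.mul_rpow (by positivity) (by positivity)]
        refine Real.rpow_le_rpow (by positivity) ?_ hθ0.le
        exact_mod_cast Nat.le_of_dvd (Nat.factorial_pos _)
          (Nat.factorial_mul_factorial_dvd_factorial_add m l)
      calc _ ≤ (B₁ * C₁ ^ m * (m.factorial : ℝ) ^ θ) *
            (C₂ * C₂ ^ l * (l.factorial : ℝ) ^ θ * Real.exp (-c * ‖y - x‖ ^ 2)) :=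
            mul_le_mul (hfd j m y) (hgd x j l y) (norm_nonneg _) (by positivity)
        _ ≤ (B₁ * C ^ m * (m.factorial : ℝ) ^ θ) *
            (C₂ * C ^ l * (l.factorial : ℝ) ^ θ * Real.exp (-c * ‖y - x‖ ^ 2)) := by
            gcongr
            · exact le_max_left _ _
            · exact le_max_right _ _
        _ = B₁ * C₂ * C ^ (m + l) * ((m.factorial : ℝ) ^ θ * (l.factorial : ℝ) ^ θ) *
            Real.exp (-c * ‖y - x‖ ^ 2) := by rw [pow_add]; ring
        _ ≤ _ := by gcongr
    have hcd : ∀ (j : Fin d) (m : ℕ),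
        ContDiff ℝ ((⊤ : ℕ∞) : WithTop ℕ∞) ((partialDeriv j)^[m] f) :=
      fun j m => contDiff_iterate_partialDeriv hf.1 j m
    have hcg : ∀ (x : RSpace d) (j : Fin d) (m : ℕ),
        ContDiff ℝ ((⊤ : ℕ∞) : WithTop ℕ∞) ((partialDeriv j)^[m] (packet M (x, 0))) :=
      fun x j m => contDiff_iterate_partialDeriv (contDiff_packet M _) j m
    have hint : ∀ (x : RSpace d) (j : Fin d) (m l : ℕ), Integrable fun y =>
        (partialDeriv j)^[m] f y * (partialDeriv j)^[l] (packet M (x, 0)) y := fun x j m l =>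
      ((integrable_exp_neg_mul_norm_sub_sq hc x).const_mul _).mono'
        ((hcd j m).continuous.mul (hcg x j l).continuous).aestronglyMeasurable
        (ae_of_all _ (hptw x j m l))
    -- Each integration by parts doubles the number of terms and raises the total order by one. The
    -- bound depends on `m` and `l` only through `m + l`, so the induction closes with `(2C)^n`.
    have hJ : ∀ (x η : RSpace d) (j : Fin d) (n m l : ℕ), (2 * Real.pi * |η j|) ^ n *
        ‖∫ y, (partialDeriv j)^[m] f y * (partialDeriv j)^[l] (packet M (x, 0)) y * expChar η y‖ ≤
          B * (2 * C) ^ n * C ^ (m + l) * ((m + l + n).factorial : ℝ) ^ θ := by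
      intro x η j n
      induction n with
      | zero =>
        intro m l
        have := norm_integral_le_of_norm_le_gaussian (x := x) (c := c) hc
          (B := B₁ * C₂ * C ^ (m + l) * ((m + l).factorial : ℝ) ^ θ) (g := fun y =>
            (partialDeriv j)^[m] f y * (partialDeriv j)^[l] (packet M (x, 0)) y * expChar η y)
          (fun y => by rw [norm_mul, norm_expChar, mul_one]; exact hptw x j m l y)
        rw [pow_zero, pow_zero, one_mul, mul_one, add_zero]
        refine this.trans (le_of_eq ?_)
        rw [hB]; ring
      | succ n ih =>
        intro m l
        have h1 := two_pi_mul_norm_integral_le (hcd j m) (hcg x j l) j η (hint x j m l)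
          (by simpa only [Function.iterate_succ_apply'] using hint x j (m + 1) l)
          (by simpa only [Function.iterate_succ_apply'] using hint x j m (l + 1))
        have h2 := ih (m + 1) l
        have h3 := ih m (l + 1)
        rw [Function.iterate_succ_apply'] at h2 h3
        have e1 : m + 1 + l + n = m + l + (n + 1) := by ring
        have e2 : m + (l + 1) + n = m + l + (n + 1) := by ring
        have e3 : m + 1 + l = m + l + 1 := by ring
        rw [e1, e3] at h2
        rw [e2, ← add_assoc] at h3
        rw [pow_succ, mul_assoc]
        refine (mul_le_mul_of_nonneg_left h1 (by positivity)).trans ?_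
        rw [mul_add]
        refine (add_le_add h2 h3).trans (le_of_eq ?_)
        ring
    -- `K₁` is added because the passage from coordinates to the norm also needs a bound without
    -- decay; the estimate in the position variable supplies it.
    refine ⟨θ / (2 * (2 * C) ^ (1 / θ)) / (d + 1) ^ (1 / θ), by positivity,
      2 ^ θ * B + K₁, by positivity, fun p => ?_⟩
    have hrew : ∫ y, f y * packet M p y = ∫ y, f y * packet M (p.1, 0) y * expChar p.2 y := by
      congr 1
      funext y
      rw [mul_assoc, expChar, ← packet_eq_mul_exp]
    have hcoord : ∀ j, ‖∫ y, f y * packet M p y‖ ≤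
        (2 ^ θ * B + K₁) * Real.exp (-(θ / (2 * (2 * C) ^ (1 / θ))) * |p.2 j| ^ (1 / θ)) := fun j => by
      have h1 := le_exp_neg_of_forall_pow_mul_le (A := ‖∫ y, f y * packet M p y‖) hθ0
        (by positivity : 0 < 2 * C) (by positivity : 0 ≤ 2 * Real.pi * |p.2 j|) (norm_nonneg _) hB0
        (fun n => by
          rw [hrew]
          have := hJ p.1 p.2 j n 0 0
          simpa using this)
      refine h1.trans ?_
      have h2 : |p.2 j| ≤ 2 * Real.pi * |p.2 j| :=
        le_mul_of_one_le_left (abs_nonneg _) (by linarith [Real.pi_gt_three])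
      have h3 : θ / (2 * (2 * C) ^ (1 / θ)) * |p.2 j| ^ (1 / θ) ≤
          θ / (2 * (2 * C) ^ (1 / θ)) * (2 * Real.pi * |p.2 j|) ^ (1 / θ) := by gcongr
      refine mul_le_mul (by linarith) (Real.exp_le_exp.2 ?_) (by positivity) (by positivity)
      linarith
    refine le_exp_neg_norm_rpow_of_forall_coord (by positivity) hq (by positivity) ?_ hcoord
    have h3 : Real.exp (-ε₁ * ‖p.1‖ ^ (1 / θ)) ≤ 1 := by
      rw [Real.exp_le_one_iff, neg_mul, neg_nonpos]
      positivity
    have h4 := (h₁ p).trans (mul_le_of_le_one_right hK₁ h3)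
    have h5 : 0 ≤ 2 ^ θ * B := by positivity
    linarith
  obtain ⟨ε₂, hε₂, K₂, hK₂, h₂⟩ := hη
  refine ⟨min ε₁ ε₂, lt_min hε₁ hε₂, max K₁ K₂, le_max_of_le_left hK₁, fun p => ?_⟩
  rcases max_cases ‖p.1‖ ‖p.2‖ with ⟨h, -⟩ | ⟨h, -⟩
  · rw [Prod.norm_def, h]
    refine (h₁ p).trans ?_
    gcongr
    · exact le_max_left _ _
    · exact min_le_left _ _
  · rw [Prod.norm_def, h]
    refine (h₂ p).trans ?_
    gcongr
    · exact le_max_right _ _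
    · exact min_le_right _ _

end Transform

/-! ### Inversion formula and reconstruction of ultradistributions. -/

/-- The matrix of the complex conjugate Gaussian. -/
noncomputable def conjNeg (M : Matrix (Fin d) (Fin d) ℂ) : Matrix (Fin d) (Fin d) ℂ :=
  -(M.map (starRingEnd ℂ))

lemma isSymm_conjNeg {M : Matrix (Fin d) (Fin d) ℂ} (hM : M.IsSymm) : (conjNeg M).IsSymm :=
  (hM.map _).neg

lemma conjNeg_map_im (M : Matrix (Fin d) (Fin d) ℂ) :
    (conjNeg M).map Complex.im = M.map Complex.im := by
  ext i j
  simp [conjNeg]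

/-- Conjugating `e^{(i/2)⟨Mt, t⟩}` replaces `M` by minus its conjugate, so analysing with `conjNeg
M` and synthesising with `M` produces the squared modulus of the window. -/
lemma packet_conjNeg_mul_packet (M : Matrix (Fin d) (Fin d) ℂ) (x y : RSpace d) :
    packet (conjNeg M) (x, 0) y * packet M (x, 0) y = (‖packet M (x, 0) y‖ ^ 2 : ℝ) := by
  have h : packet (conjNeg M) (x, 0) y = starRingEnd ℂ (packet M (x, 0) y) := by
    simp only [packet, packetExt, Function.comp_apply, ← Complex.exp_conj]
    congr 1
    simp [conjNeg, dotProduct, Matrix.mulVec, Finset.mul_sum, map_ofNat]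
  rw [h, mul_comm, Complex.mul_conj, Complex.normSq_eq_norm_sq]

lemma packet_translate (M : Matrix (Fin d) (Fin d) ℂ) (x y : RSpace d) :
    packet M (x, 0) y = packet M (0, 0) (y - x) := by
  simp [packet, packetExt]

/-- The squared `L²` norm of the Gaussian window. -/
noncomputable def windowMass (M : Matrix (Fin d) (Fin d) ℂ) : ℝ :=
  ∫ y : RSpace d, ‖packet M (0, 0) y‖ ^ 2

lemma windowMass_pos {M : Matrix (Fin d) (Fin d) ℂ} (hP : (M.map Complex.im).PosDef) :
    0 < windowMass M := by
  obtain ⟨c, hc, hb⟩ := exists_norm_packet_le hP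
  have hne : ∀ y, packet M (0, 0) y ≠ 0 := fun y => Complex.exp_ne_zero _
  have hint : Integrable fun y : RSpace d => ‖packet M (0, 0) y‖ ^ 2 := by
    refine (integrable_exp_neg_mul_norm_sub_sq hc 0).mono'
      ((contDiff_packet M _).continuous.norm.pow 2).aestronglyMeasurable (ae_of_all _ fun y => ?_)
    have h1 := hb (0, 0) y
    have h2 : Real.exp (-c * ‖y - 0‖ ^ 2) ≤ 1 := by
      rw [Real.exp_le_one_iff, neg_mul, neg_nonpos]; positivity
    rw [Real.norm_of_nonneg (by positivity), pow_two]
    exact (mul_le_of_le_one_left (norm_nonneg _) (h1.trans h2)).trans h1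
  rw [windowMass, integral_pos_iff_support_of_nonneg (fun _ => by positivity) hint]
  have : Function.support (fun y : RSpace d => ‖packet M (0, 0) y‖ ^ 2) = Set.univ := by
    ext y
    simp [hne y]
  rw [this]
  exact NeZero.pos _

/-- The short-time Fourier transform of an ultradistribution with a Gaussian window. -/
noncomputable def GSDual.stft {θ : ℝ} (hθ : 1 / 2 ≤ θ) (hθ' : θ < 1)
    {M : Matrix (Fin d) (Fin d) ℂ} (hM : M.IsSymm) (hP : (M.map Complex.im).PosDef)
    (u : GSDual d θ) (p : RSpace d × RSpace d) : ℂ :=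
  u.toLinearMap (packetGS hθ hθ' hM hP p)

/-- Reflection in the frequency variable. -/
def freqNeg (p : RSpace d × RSpace d) : RSpace d × RSpace d := (p.1, -p.2)

lemma norm_freqNeg (p : RSpace d × RSpace d) : ‖freqNeg p‖ = ‖p‖ := by
  simp [freqNeg, Prod.norm_def]

lemma continuous_freqNeg : Continuous (freqNeg (d := d)) := by
  unfold freqNeg
  fun_prop

lemma integral_freqNeg (g : RSpace d × RSpace d → ℂ) : ∫ p, g (freqNeg p) = ∫ p, g p := by
  have h : MeasurePreserving
      (MeasurableEquiv.prodCongr (MeasurableEquiv.refl (RSpace d)) (MeasurableEquiv.neg (RSpace d)))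
      (volume.prod volume) (volume.prod volume) :=
    (MeasurePreserving.id _).prod (Measure.measurePreserving_neg _)
  exact h.integral_comp' g

lemma fourier_mul_packet (M : Matrix (Fin d) (Fin d) ℂ) (g : RSpace d → ℂ) (x η : RSpace d) :
    𝓕 (fun y => g y * packet M (x, 0) y) η = ∫ y, g y * packet M (x, η) y := by
  rw [Real.fourier_eq']
  congr 1
  funext y
  rw [packet_eq_mul_exp M x η y, smul_eq_mul]
  ring

/-- Inversion formula for the short-time Fourier transform on `S_θ`. -/
theorem integral_stft_mul_packet {θ : ℝ} (hθ : 1 / 2 ≤ θ) (hθ' : θ < 1)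
    {M : Matrix (Fin d) (Fin d) ℂ} (hM : M.IsSymm) (hP : (M.map Complex.im).PosDef)
    {g : RSpace d → ℂ} (hg : MemGS θ g) (y : RSpace d) :
    ∫ p, (∫ y', g y' * packet (conjNeg M) (freqNeg p) y') * packet M p y =
      windowMass M * g y := by
  have hθ0 : 0 < θ := by linarith
  have hq : 1 ≤ 1 / θ := by rw [le_div_iff₀ hθ0]; linarith
  have hM' := isSymm_conjNeg hM
  have hP' : ((conjNeg M).map Complex.im).PosDef := by rwa [conjNeg_map_im]
  obtain ⟨ε, hε, K, hK, hdec⟩ := exists_norm_integral_mul_packet_le hθ hθ' hP' hg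
  set S : RSpace d × RSpace d → ℂ := fun p => ∫ y', g y' * packet (conjNeg M) p y' with hS
  have hScont : Continuous S :=
    -- Viewing `g` as an ultradistribution gives continuity of its transform from that of the
    -- packets.
    (GSDual.ofGS hθ0 hθ' ⟨g, hg⟩).continuous_packetGS hθ hθ' hM' hP'
  obtain ⟨c, hc, hb⟩ := exists_norm_packet_le hP
  have hb1 : ∀ p y, ‖packet M p y‖ ≤ 1 := fun p y => (hb p y).trans (by
    rw [Real.exp_le_one_iff, neg_mul, neg_nonpos]; positivity)
  have hint : Integrable (fun p => S (freqNeg p) * packet M p y) := by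
    refine ((integrable_exp_neg_mul_norm_rpow_prod hε hq).const_mul K).mono' ?_
      (ae_of_all _ fun p => ?_)
    · exact ((hScont.comp continuous_freqNeg).mul ((continuous_packet_uncurry M).comp
        (continuous_id.prodMk continuous_const))).aestronglyMeasurable
    · have := hdec (freqNeg p)
      rw [norm_freqNeg] at this
      rw [norm_mul]
      exact (mul_le_of_le_one_right (norm_nonneg _) (hb1 p y)).trans this
  rw [Measure.volume_eq_prod] at hint ⊢
  rw [integral_prod _ hint]
  -- For fixed `x` the `η`-integral is Fourier inversion for `g` times the conjugate window; the
  -- reflection of frequencies turns `𝓕` into `𝓕⁻`. Integrating in `x` then leaves the mass of the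
  -- window.
  have hinner : ∀ x : RSpace d, ∫ η : RSpace d, S (freqNeg (x, η)) * packet M (x, η) y =
      g y * (‖packet M (0, 0) (y - x)‖ ^ 2 : ℝ) := by
    intro x
    set φ : RSpace d → ℂ := fun y => g y * packet (conjNeg M) (x, 0) y with hφ
    have hφint : Integrable φ := hg.integrable_mul hθ0 hθ' (memGS_packet hθ hθ' hM' hP' (x, 0))
    have hφcont : Continuous φ := hg.1.continuous.mul (contDiff_packet _ _).continuous
    have hF : 𝓕 φ = fun η => S (x, η) := funext fun η => fourier_mul_packet _ _ _ _
    have hFint : Integrable (𝓕 φ) := by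
      rw [hF]
      refine ((integrable_exp_neg_mul_norm_rpow volume hε hq).const_mul K).mono'
        (hScont.comp (continuous_const.prodMk continuous_id)).aestronglyMeasurable
        (ae_of_all _ fun η => (hdec (x, η)).trans ?_)
      have : ‖η‖ ^ (1 / θ) ≤ ‖(x, η)‖ ^ (1 / θ) :=
        Real.rpow_le_rpow (norm_nonneg _) (norm_snd_le (x, η)) (by positivity)
      refine mul_le_mul_of_nonneg_left (Real.exp_le_exp.2 ?_) hK
      nlinarith
    have hinv := congrFun (hφcont.fourier_fourierInv_eq hφint hFint) y
    rw [Real.fourier_eq'] at hinv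
    have hpt : ∀ η, S (freqNeg (x, η)) * packet M (x, η) y = packet M (x, 0) y *
        (Complex.exp (((-2 * Real.pi * inner ℝ η y : ℝ) : ℂ) * Complex.I) • 𝓕⁻ φ η) := fun η => by
      rw [Real.fourierInv_eq_fourier_neg, hF, packet_eq_mul_exp M x η y, smul_eq_mul,
        real_inner_comm]
      simp only [freqNeg]
      ring
    simp only [hpt]
    rw [integral_const_mul, hinv, hφ, ← packet_translate, ← packet_conjNeg_mul_packet]
    ring
  simp only [hinner]
  rw [integral_const_mul, integral_complex_ofReal,
    integral_sub_left_eq_self (fun t : RSpace d => ‖packet M (0, 0) t‖ ^ 2) volume y, mul_comm]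
  rfl

/-- An ultradistribution whose short-time Fourier transform decays exponentially lies in `S_θ`. -/
theorem GSDual.isGS_of_stft_decay {θ ε K : ℝ} (hθ : 1 / 2 ≤ θ) (hθ' : θ < 1)
    {M : Matrix (Fin d) (Fin d) ℂ} (hM : M.IsSymm) (hP : (M.map Complex.im).PosDef)
    (u : GSDual d θ) (hε : 0 < ε)
    (hdec : ∀ p, ‖u.stft hθ hθ' hM hP p‖ ≤ K * Real.exp (-ε * ‖p‖ ^ (1 / θ))) : u.IsGS := by
  have hθ0 : 0 < θ := by linarith
  have hM' := isSymm_conjNeg hM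
  have hP' : ((conjNeg M).map Complex.im).PosDef := by rwa [conjNeg_map_im]
  have hN := windowMass_pos hP
  have hNc : (windowMass M : ℂ) ≠ 0 := by exact_mod_cast hN.ne'
  have hcont : Continuous (u.stft hθ hθ' hM hP) := u.continuous_packetGS hθ hθ' hM hP
  -- `F` is, up to the window mass, the function representing `u`.
  obtain ⟨F, -, hF⟩ := exists_superposition (h := fun p => u.stft hθ hθ' hM hP (freqNeg p))
    hθ hθ' hM' hP' hε (hcont.comp continuous_freqNeg).aestronglyMeasurable
    (fun p => by simpa only [norm_freqNeg] using hdec (freqNeg p))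
  refine ⟨(windowMass M : ℂ)⁻¹ • F, fun g => ?_⟩
  set v := GSDual.ofGS hθ0 hθ' g with hv
  have hvF := hF v
  obtain ⟨ε', hε', K', hK', hdec'⟩ := exists_norm_integral_mul_packet_le hθ hθ' hP' g.2
  have hvcont : Continuous (v.stft hθ hθ' hM' hP') := v.continuous_packetGS hθ hθ' hM' hP'
  obtain ⟨G, hG, hGu⟩ := exists_superposition (h := fun p => v.stft hθ hθ' hM' hP' (freqNeg p))
    hθ hθ' hM hP hε' (hvcont.comp continuous_freqNeg).aestronglyMeasurable
    (fun p => by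
      have := hdec' (freqNeg p)
      rwa [norm_freqNeg] at this)
  have hGg : G = (windowMass M : ℂ) • g := by
    ext y
    rw [hG y]
    exact integral_stft_mul_packet hθ hθ' hM hP g.2 y
  have h1 := hGu u
  rw [hGg, map_smul, smul_eq_mul] at h1
  -- Reflecting the frequency in the integral exchanges the roles of `u` and `g`.
  have h2 : ∫ p, v.stft hθ hθ' hM' hP' (freqNeg p) * u.toLinearMap (packetGS hθ hθ' hM hP p) =
      ∫ p, u.stft hθ hθ' hM hP (freqNeg p) * v.toLinearMap (packetGS hθ hθ' hM' hP' p) := by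
    rw [← integral_freqNeg]
    congr 1
    funext p
    have : freqNeg (freqNeg p) = p := by simp [freqNeg]
    rw [this, mul_comm]
    rfl
  rw [h2, ← hvF] at h1
  have h3 : v.toLinearMap F = ∫ y, (g : RSpace d → ℂ) y * (F : RSpace d → ℂ) y := rfl
  rw [h3] at h1
  calc u.toLinearMap g = (windowMass M : ℂ)⁻¹ * (windowMass M * u.toLinearMap g) := by
        field_simp
    _ = _ := by
        rw [h1, ← integral_const_mul]
        congr 1
        funext y
        simp
        ring

/-! ### FBI phases in wave packet coordinates. -/

namespace FBIPhase

variable (φ : FBIPhase d)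

lemma B_mulVec_chiFlat (x ξ : RSpace d) :
    φ.B *ᵥ (φ.chiFlat x ξ).ofLp = -(realEmbed d ξ + φ.C *ᵥ realEmbed d x) := by
  have hB : IsUnit φ.B.det := isUnit_iff_ne_zero.2 φ.det_B_ne_zero
  simp only [chiFlat, ← realEmbed_eq_toComplexCoords, Matrix.mulVec_neg, Matrix.mulVec_mulVec,
    Matrix.mul_nonsing_inv _ hB, Matrix.one_mulVec]

/-- Exact second-order Taylor expansion at `y = x`, where the derivative is `-ξ` by the choice of
`χ♭`. -/
lemma phase_chiFlat (x ξ y : RSpace d) :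
    φ.phase (φ.chiFlat x ξ) y = φ.phase (φ.chiFlat x ξ) x - realEmbed d ξ ⬝ᵥ realEmbed d (y - x)
      + (1 / 2 : ℂ) * ((φ.C *ᵥ realEmbed d (y - x)) ⬝ᵥ realEmbed d (y - x)) := by
  have hsym : (φ.C *ᵥ realEmbed d y) ⬝ᵥ realEmbed d x = (φ.C *ᵥ realEmbed d x) ⬝ᵥ realEmbed d y := by
    rw [dotProduct_comm, Matrix.dotProduct_mulVec, ← Matrix.mulVec_transpose, φ.C_symm.eq]
  simp only [phase, B_mulVec_chiFlat, ← realEmbed_eq_toComplexCoords, map_sub, Matrix.mulVec_sub,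
    sub_dotProduct, dotProduct_sub, neg_dotProduct, add_dotProduct, hsym]
  ring

lemma im_phase_chiFlat (x ξ y : RSpace d) :
    (φ.phase (φ.chiFlat x ξ) y).im = (φ.phase (φ.chiFlat x ξ) x).im +
      (1 / 2) * (((φ.C.map Complex.im) *ᵥ (y - x).ofLp) ⬝ᵥ (y - x).ofLp) := by
  rw [φ.phase_chiFlat x ξ y, ← im_mulVec_dotProduct_realEmbed]
  have h1 : (realEmbed d ξ ⬝ᵥ realEmbed d (y - x)).im = 0 := by simp [dotProduct]
  have h2 : (1 / 2 : ℂ) = ((1 / 2 : ℝ) : ℂ) := by push_cast; rfl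
  rw [Complex.add_im, Complex.sub_im, h1, h2, Complex.im_ofReal_mul]
  ring

/-- As `ξ` is real, `Im φ` has no linear term at `x`, and `Im C > 0` makes `x` the maximum point. -/
lemma weight_chiFlat (x ξ : RSpace d) :
    φ.weight (φ.chiFlat x ξ) = -(φ.phase (φ.chiFlat x ξ) x).im := by
  have hle : ∀ y, -(φ.phase (φ.chiFlat x ξ) y).im ≤ -(φ.phase (φ.chiFlat x ξ) x).im := fun y => by
    have h1 := φ.im_C_posDef.posSemidef.dotProduct_mulVec_nonneg (y - x).ofLp
    rw [star_trivial, dotProduct_comm] at h1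
    rw [φ.im_phase_chiFlat x ξ y]
    linarith
  exact le_antisymm (ciSup_le hle) (le_ciSup (f := fun y => -(φ.phase (φ.chiFlat x ξ) y).im)
    ⟨_, by rintro _ ⟨y, rfl⟩; exact hle y⟩ x)

/-- `χ♭` with the frequency normalised as in `packet`. -/
noncomputable def chiLinear : (RSpace d × RSpace d) →ₗ[ℝ] CSpace d where
  toFun p := φ.chiFlat p.1 ((2 * Real.pi) • p.2)
  map_add' p q := by
    simp only [chiFlat, ← realEmbed_eq_toComplexCoords, Prod.fst_add, Prod.snd_add, smul_add,
      map_add, Matrix.mulVec_add]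
    rw [← WithLp.toLp_add]
    congr 1
    abel
  map_smul' t p := by
    simp only [chiFlat, ← realEmbed_eq_toComplexCoords, Prod.smul_fst, Prod.smul_snd, map_smul,
      RingHom.id_apply, Matrix.mulVec_add, Matrix.mulVec_smul]
    rw [← WithLp.toLp_smul]
    congr 1
    rw [smul_neg, smul_add, smul_comm t]

/-- If `ξ + Cx = 0` with `ξ` real, pairing with `x` and taking imaginary parts gives `⟨Im C x, x⟩ =
0`, hence `x = 0` and then `ξ = 0`. -/
lemma chiLinear_injective : Function.Injective φ.chiLinear := by
  rw [injective_iff_map_eq_zero]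
  intro p hp
  have h := φ.B_mulVec_chiFlat p.1 ((2 * Real.pi) • p.2)
  have hp' : φ.chiFlat p.1 ((2 * Real.pi) • p.2) = 0 := hp
  rw [hp', WithLp.ofLp_zero, Matrix.mulVec_zero, eq_comm, neg_eq_zero] at h
  have h1 : p.1 = 0 := by
    by_contra hne
    have h2 := φ.im_C_posDef.dotProduct_mulVec_pos (x := p.1.ofLp) (by simpa using hne)
    rw [star_trivial, dotProduct_comm, ← im_mulVec_dotProduct_realEmbed] at h2
    have h3 : φ.C *ᵥ realEmbed d p.1 = -realEmbed d ((2 * Real.pi) • p.2) := by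
      rw [eq_neg_iff_add_eq_zero, add_comm]; exact h
    rw [h3] at h2
    simp [dotProduct] at h2
  have h4 : realEmbed d ((2 * Real.pi) • p.2) = 0 := by simpa [h1] using h
  have h5 : p.2 = 0 := by
    ext i
    have := congrFun h4 i
    simpa [Real.pi_ne_zero] using this
  exact Prod.ext h1 h5

/-- `chiLinear` as a continuous linear equivalence. -/
noncomputable def chiEquiv : (RSpace d × RSpace d) ≃L[ℝ] CSpace d :=
  (LinearEquiv.ofInjectiveOfFinrankEq φ.chiLinear φ.chiLinear_injective (by
    rw [Module.finrank_prod, finrank_real_of_complex]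
    simp
    ring)).toContinuousLinearEquiv

lemma chiEquiv_apply (p : RSpace d × RSpace d) :
    φ.chiEquiv p = φ.chiFlat p.1 ((2 * Real.pi) • p.2) := rfl

/-- The constant Taylor term supplies the modulus `e^{Φ}`. The unimodular part of `κ` also carries
`e^{i⟨ξ, x⟩}`, because the character in `packet` is not recentred at `x`. -/
lemma kernel_chiEquiv (p : RSpace d × RSpace d) :
    ∃ κ : ℂ, ‖κ‖ = Real.exp (φ.weight (φ.chiEquiv p)) ∧
      φ.kernel (φ.chiEquiv p) = κ • packet φ.C p := by
  set ξ := (2 * Real.pi) • p.2 with hξ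
  refine ⟨Complex.exp (Complex.I * (φ.phase (φ.chiFlat p.1 ξ) p.1 +
    realEmbed d ξ ⬝ᵥ realEmbed d p.1)), ?_, ?_⟩
  · rw [chiEquiv_apply, ← hξ, weight_chiFlat, Complex.norm_exp, Complex.I_mul_re, Complex.add_im]
    have : (realEmbed d ξ ⬝ᵥ realEmbed d p.1).im = 0 := by simp [dotProduct]
    rw [this, add_zero]
  · funext y
    rw [kernel, chiEquiv_apply, ← hξ, phase_chiFlat, Pi.smul_apply, smul_eq_mul, packet,
      Function.comp_apply, packetExt, ← Complex.exp_add]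
    congr 1
    have h1 : realEmbed d ξ = (2 * (Real.pi : ℂ)) • realEmbed d p.2 := by
      ext i
      simp [hξ]
    rw [map_sub, h1, smul_dotProduct, smul_dotProduct, dotProduct_sub, smul_eq_mul, smul_eq_mul]
    ring

lemma normConst_pos : 0 < φ.normConst := by
  have h1 := φ.im_C_posDef.det_pos
  have h2 := norm_pos_iff.2 φ.det_B_ne_zero
  have h3 := Real.pi_pos
  unfold normConst
  positivity

end FBIPhase

/-- This is the bridge between the two transforms: dividing by `e^{Φ}` turns the regularity estimate
into plain decay of the `stft`. The kernel lies in `S_θ`, so the default branch of `fbi` is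
excluded. -/
lemma GSDual.norm_fbi_chiEquiv {θ : ℝ} (hθ : 1 / 2 ≤ θ) (hθ' : θ < 1) (φ : FBIPhase d)
    (u : GSDual d θ) (p : RSpace d × RSpace d) :
    ‖u.fbi φ (φ.chiEquiv p)‖ = φ.normConst * Real.exp (φ.weight (φ.chiEquiv p)) *
      ‖u.stft hθ hθ' φ.C_symm φ.im_C_posDef p‖ := by
  obtain ⟨κ, hκ, hk⟩ := φ.kernel_chiEquiv p
  have hmem : φ.kernel (φ.chiEquiv p) ∈ GS d θ := by
    rw [hk]
    exact (GS d θ).smul_mem κ (memGS_packet hθ hθ' φ.C_symm φ.im_C_posDef p)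
  have heq : (⟨φ.kernel (φ.chiEquiv p), hmem⟩ : GS d θ) =
      κ • packetGS hθ hθ' φ.C_symm φ.im_C_posDef p := Subtype.ext hk
  rw [GSDual.fbi, dif_pos hmem, heq, map_smul, norm_mul, smul_eq_mul, norm_mul, hκ,
    Complex.norm_real, Real.norm_of_nonneg φ.normConst_pos.le, GSDual.stft, mul_assoc]

/-! ### From conic decay to global decay, and the two implications. -/

lemma exists_mul_norm_rpow_le {E F : Type*} [NormedAddCommGroup E] [NormedSpace ℝ E]
    [NormedAddCommGroup F] [NormedSpace ℝ F] (L : E →L[ℝ] F) {q : ℝ} (hq : 0 ≤ q) :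
    ∃ a : ℝ, 0 < a ∧ ∀ v, a * ‖L v‖ ^ q ≤ ‖v‖ ^ q := by
  refine ⟨((‖L‖ + 1) ^ q)⁻¹, by positivity, fun v => ?_⟩
  rw [inv_mul_le_iff₀ (by positivity), ← Real.mul_rpow (by positivity) (norm_nonneg v)]
  refine Real.rpow_le_rpow (norm_nonneg _) ((L.le_opNorm v).trans ?_) hq
  gcongr
  linarith

/-- A function with conically uniform exponential decay near every point of the unit sphere decays
exponentially. -/
lemma exists_decay_of_conic_decay {E : Type*} [NormedAddCommGroup E] [NormedSpace ℝ E]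
    [ProperSpace E] {V : E → ℂ} {q : ℝ} (hq : 0 < q)
    (h : ∀ p : E, p ≠ 0 → ∃ U ∈ 𝓝 p, ∃ ε : ℝ, 0 < ε ∧ ∃ K : ℝ, 0 < K ∧ ∀ p' ∈ U, ∀ t : ℝ, 0 < t →
      ‖V (t • p')‖ ≤ K * Real.exp (-ε * ‖t • p'‖ ^ q)) :
    ∃ ε : ℝ, 0 < ε ∧ ∃ K : ℝ, ∀ p, ‖V p‖ ≤ K * Real.exp (-ε * ‖p‖ ^ q) := by
  obtain ⟨ε, hε, K, hK, hb⟩ := (isCompact_sphere (0 : E) 1).induction_on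
    (p := fun s => ∃ ε : ℝ, 0 < ε ∧ ∃ K : ℝ, 0 < K ∧ ∀ p' ∈ s, ∀ t : ℝ, 0 < t →
      ‖V (t • p')‖ ≤ K * Real.exp (-ε * ‖t • p'‖ ^ q))
    ⟨1, one_pos, 1, one_pos, by simp⟩
    (fun s t hst ⟨ε, hε, K, hK, hb⟩ => ⟨ε, hε, K, hK, fun p hp => hb p (hst hp)⟩)
    (fun s t ⟨ε₁, hε₁, K₁, hK₁, h₁⟩ ⟨ε₂, hε₂, K₂, hK₂, h₂⟩ => by
      refine ⟨min ε₁ ε₂, lt_min hε₁ hε₂, max K₁ K₂, lt_max_of_lt_left hK₁, fun p hp r hr => ?_⟩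
      rcases hp with hp | hp
      · refine (h₁ p hp r hr).trans ?_
        gcongr
        · exact le_max_left _ _
        · exact min_le_left _ _
      · refine (h₂ p hp r hr).trans ?_
        gcongr
        · exact le_max_right _ _
        · exact min_le_right _ _)
    (fun p hp => by
      obtain ⟨U, hU, hb⟩ := h p (by rintro rfl; simp at hp)
      exact ⟨U, mem_nhdsWithin_of_mem_nhds hU, hb⟩)
  -- The origin lies on no open ray, so its value is added to the constant.
  refine ⟨ε, hε, K + ‖V 0‖, fun p => ?_⟩
  rcases eq_or_ne p 0 with rfl | hp
  · rw [norm_zero, Real.zero_rpow hq.ne', mul_zero, Real.exp_zero, mul_one]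
    linarith
  · have hp0 : 0 < ‖p‖ := norm_pos_iff.2 hp
    have := hb (‖p‖⁻¹ • p) (by simp [norm_smul, hp]) ‖p‖ hp0
    rw [smul_inv_smul₀ hp0.ne'] at this
    refine this.trans ?_
    gcongr
    linarith [norm_nonneg (V 0)]

lemma GSDual.waveFrontSet_eq_empty_of_isGS {θ : ℝ} (hθ : 1 / 2 ≤ θ) (hθ' : θ < 1)
    (φ : FBIPhase d) (u : GSDual d θ) (hu : u.IsGS) : u.waveFrontSet φ = ∅ := by
  have hθ0 : 0 < θ := by linarith
  obtain ⟨f, hf⟩ := hu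
  obtain ⟨ε, hε, K, hK, hdec⟩ := exists_norm_integral_mul_packet_le hθ hθ' φ.im_C_posDef f.2
  obtain ⟨a, ha, hab⟩ := exists_mul_norm_rpow_le φ.chiEquiv.toContinuousLinearMap
    (by positivity : 0 ≤ 1 / θ)
  have hn := φ.normConst_pos
  rw [Set.eq_empty_iff_forall_notMem]
  rintro ⟨x, ξ⟩ ⟨-, hreg⟩
  -- The decay is global, so the cone may be all of `ℂ^d`; `K + 1` replaces `K`, which may vanish,
  -- to get a positive constant.
  refine hreg ⟨Set.univ, isOpen_univ, fun _ _ _ _ => trivial, trivial, ε * a, by positivity,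
    φ.normConst * (K + 1), by positivity, fun z _ => ?_⟩
  obtain ⟨p, rfl⟩ := φ.chiEquiv.surjective z
  have h1 : ‖u.stft hθ hθ' φ.C_symm φ.im_C_posDef p‖ ≤ K * Real.exp (-ε * ‖p‖ ^ (1 / θ)) := by
    rw [GSDual.stft, hf]
    exact hdec p
  have h2 := hab p
  rw [ContinuousLinearEquiv.coe_coe] at h2
  have h3 : ε * (a * ‖φ.chiEquiv p‖ ^ (1 / θ)) ≤ ε * ‖p‖ ^ (1 / θ) := by gcongr
  rw [u.norm_fbi_chiEquiv hθ hθ']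
  calc φ.normConst * Real.exp (φ.weight (φ.chiEquiv p)) *
        ‖u.stft hθ hθ' φ.C_symm φ.im_C_posDef p‖
      ≤ φ.normConst * Real.exp (φ.weight (φ.chiEquiv p)) *
        ((K + 1) * Real.exp (-(ε * a) * ‖φ.chiEquiv p‖ ^ (1 / θ))) := by
        refine mul_le_mul_of_nonneg_left (h1.trans ?_) (by positivity)
        refine mul_le_mul (by linarith) (Real.exp_le_exp.2 ?_) (by positivity) (by positivity)
        linarith
    _ = _ := by rw [Real.exp_add]; ring

lemma GSDual.isGS_of_waveFrontSet_eq_empty {θ : ℝ} (hθ : 1 / 2 ≤ θ) (hθ' : θ < 1)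
    (φ : FBIPhase d) (u : GSDual d θ) (hu : u.waveFrontSet φ = ∅) : u.IsGS := by
  have hθ0 : 0 < θ := by linarith
  have hn := φ.normConst_pos
  obtain ⟨a, ha, hab⟩ := exists_mul_norm_rpow_le φ.chiEquiv.symm.toContinuousLinearMap
    (by positivity : 0 ≤ 1 / θ)
  obtain ⟨ε, hε, K, hb⟩ := exists_decay_of_conic_decay
    (V := u.stft hθ hθ' φ.C_symm φ.im_C_posDef) (by positivity : 0 < 1 / θ) (fun p hp => by
      have hreg : u.IsRegularAt φ p.1 ((2 * Real.pi) • p.2) := by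
        by_contra hreg
        have hne : (p.1, (2 * Real.pi) • p.2) ≠ 0 := fun h0 => hp (by
          rw [Prod.mk_eq_zero, smul_eq_zero] at h0
          exact Prod.ext h0.1 (h0.2.resolve_left (by positivity)))
        have : (p.1, (2 * Real.pi) • p.2) ∈ u.waveFrontSet φ := ⟨hne, hreg⟩
        rw [hu] at this
        exact this
      obtain ⟨Γ, hΓ, hcone, hmem, ε, hε, K, hK, hb⟩ := hreg
      refine ⟨φ.chiEquiv ⁻¹' Γ, (hΓ.preimage φ.chiEquiv.continuous).mem_nhds hmem, ε * a,
        by positivity, K / φ.normConst, by positivity, fun p' hp' t ht => ?_⟩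
      -- By linearity of `χ♭`, the ray through `p'` is mapped into the cone `Γ`.
      have h1 := hb (φ.chiEquiv (t • p')) (by rw [map_smul]; exact hcone _ hp' t ht)
      set v := t • p'
      rw [u.norm_fbi_chiEquiv hθ hθ', Real.exp_add] at h1
      have h2 : φ.normConst * ‖u.stft hθ hθ' φ.C_symm φ.im_C_posDef v‖ ≤
          K * Real.exp (-ε * ‖φ.chiEquiv v‖ ^ (1 / θ)) :=
        le_of_mul_le_mul_right (by linarith) (Real.exp_pos (φ.weight (φ.chiEquiv v)))
      have h3 := hab (φ.chiEquiv v)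
      rw [ContinuousLinearEquiv.coe_coe, ContinuousLinearEquiv.symm_apply_apply] at h3
      rw [div_mul_eq_mul_div, le_div_iff₀ hn, mul_comm]
      refine h2.trans (mul_le_mul_of_nonneg_left (Real.exp_le_exp.2 ?_) hK.le)
      have : ε * (a * ‖v‖ ^ (1 / θ)) ≤ ε * ‖φ.chiEquiv v‖ ^ (1 / θ) := by gcongr
      linarith)
  exact u.isGS_of_stft_decay hθ hθ' φ.C_symm φ.im_C_posDef hε hb

end GelfandShilov

open GelfandShilov in
theorem mainTheorem9 (d : ℕ) (θ : ℝ) (hθ : 1 / 2 ≤ θ) (hθ' : θ < 1)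
    (φ : FBIPhase d) (u : GSDual d θ) :
    u.waveFrontSet φ = ∅ ↔ u.IsGS :=
  ⟨u.isGS_of_waveFrontSet_eq_empty hθ hθ' φ, u.waveFrontSet_eq_empty_of_isGS hθ hθ' φ⟩
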